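/- Let $r\geq 1$, $b\geq 2$ and $n\geq 2^{r+1}$ be integers, let $q=2^b$, and set $N=2^{r+1}-1$. Regard $\mathbb F_q^n\otimes_{\mathbb F_q}\mathbb F_q^n=\mathbb F_q^{n\times n}$ as a vector space over $\mathbb F_2\subseteq\mathbb F_q$. Let $G\in\mathbb F_2^{N\times(r+1)}$ be the generator matrix of the Hadamard code, whose $k$-th row ($1\leq k\leq N$) is the binary representation of the integer $2^{r+1}-k$, most significant bit first. Let $X(r)$ be the set of all $(r+1)$-dimensional $\mathbb F_2$-subspaces of $\mathbb F_q^{n\times n}$ of the form $$\Big\{\sum_{k=1}^{N}(Gc)_k\; e_k\otimes f_k \;:\; c\in\mathbb F_2^{r+1}\Big\},$$ where $e_1,\dots,e_N\in\mathbb F_q^n$ are linearly independent over $\mathbb F_q$ and $f_1,\dots,f_N\in\mathbb F_q^n$ are linearly independent over $\mathbb F_q$. Let $X=X^{r,b,n}$ be the poset, ordered by inclusion, of all $\mathbb F_2$-subspaces contained in some member of $X(r)$, with rank function $\operatorname{rank}(x)=\dim_{\mathbb F_2}(x)-1$, and let $X(i)$ be its set of elements of rank $i$. The link of $x\in X$ is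 the poset $X_x=\{y\in X: x\subseteq y\}$ with rank function $\operatorname{rank}_{X_x}(y)=\operatorname{rank}(y)-\operatorname{rank}(x)-1$. The 1-skeleton graph of a poset with a rank function has as vertices the elements of rank $0$, two distinct vertices being joined by an edge if and only if some element of rank $1$ is strictly above both. Then for every integer $i$ with $-1\leq i\leq r-2$ and every $x_i\in X(i)$, the 1-skeleton graph of the link $X_{x_i}$ is connected. -/

import Mathlib

/-- The 1-skeleton graph of a poset `P` with rank function `rank`: its vertices are the elements of
rank `0`, and two distinct vertices are adjacent if some element of rank `1` lies strictly above
both. (All weights in the standard uniform weighting are positive, so connectedness does not involve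
them.) -/
def skeletonGraph {P : Type*} [PartialOrder P] (rank : P → ℤ) :
    SimpleGraph {v : P // rank v = 0} where
  Adj v w := v ≠ w ∧ ∃ z : P, rank z = 1 ∧ v.1 < z ∧ w.1 < z
  symm := ⟨fun _ _ h => ⟨h.1.symm, h.2.imp fun _ hz => ⟨hz.1, hz.2.2, hz.2.1⟩⟩⟩
  loopless := ⟨fun _ h => h.1 rfl⟩

/-- The rank function of the link `Set.Ici x = {y | x ≤ y}` of an element `x` of a poset with rank
function `rank`. -/
def linkRank {P : Type*} [PartialOrder P] (rank : P → ℤ) (x : P) : Set.Ici x → ℤ :=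
  fun y => rank y.1 - rank x - 1

/-- The field with `q = 2 ^ b` elements. -/
abbrev Fq (b : ℕ) : Type := GaloisField 2 b

/-- The ambient space `𝔽_q^n ⊗ 𝔽_q^n`, realised as the `n × n` matrices over `𝔽_q`, where `e ⊗ f`
is the outer product `Matrix.vecMulVec e f`. It is regarded as a vector space over
`𝔽₂ = ZMod 2 ⊆ 𝔽_q`. -/
abbrev Ambient (b n : ℕ) : Type := Matrix (Fin n) (Fin n) (Fq b)

/-- The generator matrix of the Hadamard code of length `2 ^ (r + 1) - 1`: for
`1 ≤ k ≤ 2 ^ (r + 1) - 1`, its `k`-th row is the binary representation of `2 ^ (r + 1) - k`, most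
significant bit first. (In the code both indices start from `0`.) -/
def hadamardGen (r : ℕ) : Matrix (Fin (2 ^ (r + 1) - 1)) (Fin (r + 1)) (ZMod 2) :=
  Matrix.of fun k j => if (2 ^ (r + 1) - (k.1 + 1)).testBit (r - j.1) then 1 else 0

/-- The subspace `im (E * G)`, where `E` is the matrix over `𝔽₂` whose `k`-th column is
`e k ⊗ f k` and `G` is the Hadamard generator matrix. -/
noncomputable def hadamardImage (r b n : ℕ) (e f : Fin (2 ^ (r + 1) - 1) → (Fin n → Fq b)) :
    Submodule (ZMod 2) (Ambient b n) :=
  LinearMap.range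
    ((Fintype.linearCombination (ZMod 2)
        (fun k => (Matrix.vecMulVec (e k) (f k) : Ambient b n))).comp
      (hadamardGen r).mulVecLin)

/-- The top-dimensional faces `X(r)` of the Grassmannian poset `X = X^{r,b,n}`. -/
def IsTopFace (r b n : ℕ) (x : Submodule (ZMod 2) (Ambient b n)) : Prop :=
  Module.finrank (ZMod 2) x = r + 1 ∧
    ∃ e f : Fin (2 ^ (r + 1) - 1) → (Fin n → Fq b),
      LinearIndependent (Fq b) e ∧ LinearIndependent (Fq b) f ∧ x = hadamardImage r b n e f

/-- The Grassmannian poset `X^{r,b,n}`: all `𝔽₂`-subspaces of the top-dimensional faces, ordered by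
inclusion. -/
abbrev Grass (r b n : ℕ) : Type :=
  {x : Submodule (ZMod 2) (Ambient b n) // ∃ y, IsTopFace r b n y ∧ x ≤ y}

/-- The rank of a face is its `𝔽₂`-dimension minus one. -/
noncomputable def grassRank {r b n : ℕ} (x : Grass r b n) : ℤ :=
  (Module.finrank (ZMod 2) x.1 : ℤ) - 1

/-! Call a pair of invertible matrices `P`, `Q` a frame. In a suitable frame a face is a space of
matrices `P * diag (L w) * Q`, with `L` a linear family of binary words of length `n`. Which `L`
occur is a matter of counting coordinates, read as functionals. The rows of the Hadamard generator
matrix list each nonzero functional on `𝔽₂^(r+1)` once, so on a face of dimension `d` each nonzero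
functional occurs `2 ^ (r + 1 - d)` times and zero occurs `n - 2 ^ (r + 1)` times more. Conversely,
families with these counts give faces (`IsFace.exists_framedMap`, `BalancedFamily.isFace_range`).
Families with equal counts differ by a permutation of coordinates, so `L` can be fixed once for `x`.
A vertex of the link is then `x` extended, in some frame, by a word `s` that splits the fibres of
`L` evenly, up to surplus zeros (`IsLinkVertex.exists_frame`).

Within one frame, two such words are joined by swaps of coordinates `a`, `b` in a common fibre. A
word `u` equal to `1` at both `a` and `b` does not see the swap, so it can be chosen compatible with
`s` both before and after it. This gives a path of length two
(`Complementary.eqvGen_jointlyComplementary`).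

Two frames of `x` differ by a pair `(S, T)` with `S * diag (L w) * T = diag (L w)` for all `w`. Such
a pair is a product of elementary ones, each of which also fixes some complementary word
(`preservesComponents_of_fixes_words`). The extension of `x` by that word is the same in both
frames, so the components of the two frames coincide (`preservesComponents_of_fixes`). -/

open Module in
/-- The `k`-th coordinate functional of a family `L` of binary words. -/
def coordFunctional {D W : Type*} [AddCommGroup W] [Module (ZMod 2) W]
    (L : W →ₗ[ZMod 2] (D → ZMod 2)) (k : D) : Dual (ZMod 2) W :=
  (LinearMap.proj k).comp L

open Classical in
/-- A family of words `L` is balanced if every nonzero functional on `W` occurs as a coordinate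
functional equally often (`N / |W|` times), while the zero functional occurs `e` more times. -/
def BalancedFamily {D W : Type*} [Fintype D] [AddCommGroup W] [Module (ZMod 2) W] (N e : ℕ)
    (L : W →ₗ[ZMod 2] (D → ZMod 2)) : Prop :=
  ∀ h : Module.Dual (ZMod 2) W,
    (Finset.univ.filter fun k => coordFunctional L k = h).card * 2 ^ Module.finrank (ZMod 2) W =
      N + if h = 0 then e * 2 ^ Module.finrank (ZMod 2) W else 0

/-- The family of words spanned by `L` and one additional word `s`. -/
def adjoinWord {D W : Type*} [AddCommGroup W] [Module (ZMod 2) W]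
    (L : W →ₗ[ZMod 2] (D → ZMod 2)) (s : D → ZMod 2) : W × ZMod 2 →ₗ[ZMod 2] (D → ZMod 2) :=
  L.coprod (LinearMap.toSpanSingleton (ZMod 2) _ s)

/-! ### Balanced families of words and their one-word extensions -/

section Balanced

set_option linter.unusedSectionVars false

variable {D W U : Type*} [Fintype D] [AddCommGroup W] [Module (ZMod 2) W]
  [FiniteDimensional (ZMod 2) W] [AddCommGroup U] [Module (ZMod 2) U]
  [FiniteDimensional (ZMod 2) U] {N e : ℕ}

@[simp]
theorem coordFunctional_apply (L : W →ₗ[ZMod 2] (D → ZMod 2)) (k : D) (w : W) :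
    coordFunctional L k w = L w k := rfl

@[simp]
theorem adjoinWord_apply (L : W →ₗ[ZMod 2] (D → ZMod 2)) (s : D → ZMod 2) (w : W) (t : ZMod 2)
    (k : D) : adjoinWord L s (w, t) k = L w k + t * s k := by
  simp [adjoinWord]

theorem ZMod.eq_zero_or_one_of_two (t : ZMod 2) : t = 0 ∨ t = 1 := by
  revert t; decide

open Classical in
-- Restriction of functionals along an injection is a surjective homomorphism, so all its fibres
-- have the same size.
theorem card_filter_comp_eq [Fintype (Module.Dual (ZMod 2) W)] {ι : U →ₗ[ZMod 2] W}
    (hι : Function.Injective ι)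
    (h : Module.Dual (ZMod 2) U) :
    (Finset.univ.filter fun g : Module.Dual (ZMod 2) W => g.comp ι = h).card *
      2 ^ Module.finrank (ZMod 2) U = 2 ^ Module.finrank (ZMod 2) W := by
  have : Finite (Module.Dual (ZMod 2) U) := Module.finite_of_finite (ZMod 2)
  have := Fintype.ofFinite (Module.Dual (ZMod 2) U)
  have hs : Function.Surjective ι.dualMap := LinearMap.dualMap_surjective_of_injective hι
  have hall : ∀ h' : Module.Dual (ZMod 2) U,
      (Finset.univ.filter fun g : Module.Dual (ZMod 2) W => g.comp ι = h').card =
      (Finset.univ.filter fun g : Module.Dual (ZMod 2) W => g.comp ι = h).card := by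
    intro h'
    exact AddMonoidHom.card_fiber_eq_of_mem_range (ι.dualMap.toAddMonoidHom) (hs h') (hs h)
  have hc : Fintype.card (Module.Dual (ZMod 2) W) = 2 ^ Module.finrank (ZMod 2) W := by
    rw [Module.card_eq_pow_finrank (K := ZMod 2), Subspace.dual_finrank_eq, ZMod.card]
  have hc' : Fintype.card (Module.Dual (ZMod 2) U) = 2 ^ Module.finrank (ZMod 2) U := by
    rw [Module.card_eq_pow_finrank (K := ZMod 2), Subspace.dual_finrank_eq, ZMod.card]
  have hsum := Finset.card_eq_sum_card_fiberwise (s := Finset.univ)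
    (f := fun g : Module.Dual (ZMod 2) W => g.comp ι) (t := Finset.univ) (by simp)
  rw [Finset.sum_congr rfl (fun x _ => hall x), Finset.sum_const, Finset.card_univ,
    Finset.card_univ, smul_eq_mul] at hsum
  rw [← hc, ← hc', hsum, mul_comm]

/-- The fibre of a functional on `U` is the union of the fibres of its extensions to `W`, and every
functional has equally many extensions. Hence `N` and `e` survive restriction. -/
theorem BalancedFamily.comp {L : W →ₗ[ZMod 2] (D → ZMod 2)} (hL : BalancedFamily N e L)
    {ι : U →ₗ[ZMod 2] W} (hι : Function.Injective ι) : BalancedFamily N e (L.comp ι) := by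
  classical
  have : Finite (Module.Dual (ZMod 2) W) := Module.finite_of_finite (ZMod 2)
  have := Fintype.ofFinite (Module.Dual (ZMod 2) W)
  intro h
  have h1 := card_filter_comp_eq hι h
  set A := Finset.univ.filter fun g : Module.Dual (ZMod 2) W => g.comp ι = h with hA
  have h2 : (Finset.univ.filter fun k => coordFunctional (L.comp ι) k = h).card =
      ∑ g ∈ A, (Finset.univ.filter fun k => coordFunctional L k = g).card := by
    rw [Finset.card_eq_sum_card_fiberwise (f := coordFunctional L) (t := A)]
    · refine Finset.sum_congr rfl fun g hg => ?_
      congr 1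
      ext k
      simp only [Finset.mem_filter, Finset.mem_univ, true_and, hA] at hg ⊢
      refine ⟨fun hk => hk.2, fun hk => ⟨?_, hk⟩⟩
      rw [← hg, ← hk]; rfl
    · intro k hk
      simp only [hA, Finset.coe_filter, Finset.mem_univ, true_and, Set.mem_ofPred_eq] at hk ⊢
      rw [← hk]; rfl
  have h3 : (∑ g ∈ A, (Finset.univ.filter fun k => coordFunctional L k = g).card) *
      2 ^ Module.finrank (ZMod 2) W =
      A.card * N + if h = 0 then e * 2 ^ Module.finrank (ZMod 2) W else 0 := by
    rw [Finset.sum_mul, Finset.sum_congr rfl (fun g _ => hL g), Finset.sum_add_distrib]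
    congr 1
    · simp
    -- The surplus `e` is counted once, and only if the zero functional restricts to `h`, that is,
    -- if `h = 0`.
    · rw [Finset.sum_ite_eq' A 0]
      simp [hA, eq_comm]
  rw [h2]
  have hpos : 0 < 2 ^ Module.finrank (ZMod 2) W := by positivity
  apply Nat.eq_of_mul_eq_mul_right hpos
  rw [mul_right_comm, h3]
  split_ifs
  · rw [add_mul, mul_right_comm, h1]; ring
  · rw [add_zero, mul_right_comm, h1]; ring

/-- The fibres over each functional are equinumerous; bijections between them glue to a permutation.
-/
theorem BalancedFamily.exists_perm {L L' : W →ₗ[ZMod 2] (D → ZMod 2)} (hL : BalancedFamily N e L)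
    (hL' : BalancedFamily N e L') : ∃ π : Equiv.Perm D, ∀ w k, L' w (π k) = L w k := by
  classical
  have hcard : ∀ h : Module.Dual (ZMod 2) W, Nonempty ({k // coordFunctional L k = h} ≃
      {k // coordFunctional L' k = h}) := by
    intro h
    refine Fintype.card_eq.mp ?_
    rw [Fintype.card_subtype, Fintype.card_subtype]
    have hpos : 0 < 2 ^ Module.finrank (ZMod 2) W := by positivity
    exact Nat.eq_of_mul_eq_mul_right hpos ((hL h).trans (hL' h).symm)
  let φ := fun h => (hcard h).some
  let π : Equiv.Perm D := (Equiv.sigmaFiberEquiv (coordFunctional L)).symm.trans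
    ((Equiv.sigmaCongrRight φ).trans (Equiv.sigmaFiberEquiv (coordFunctional L')))
  refine ⟨π, fun w k => ?_⟩
  have : coordFunctional L' (π k) = coordFunctional L k :=
    (φ (coordFunctional L k) ⟨k, rfl⟩).2
  simpa using congrArg (fun g => g w) this

theorem BalancedFamily.exists_coord (hN : N ≠ 0) {L : W →ₗ[ZMod 2] (D → ZMod 2)}
    (hL : BalancedFamily N e L) (h : Module.Dual (ZMod 2) W) : ∃ k, ∀ w, L w k = h w := by
  classical
  have h1 := hL h
  have h2 : (Finset.univ.filter fun k => coordFunctional L k = h).card ≠ 0 := by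
    intro h0
    rw [h0, zero_mul] at h1
    omega
  obtain ⟨k, hk⟩ := Finset.card_ne_zero.mp h2
  simp only [Finset.mem_filter, Finset.mem_univ, true_and] at hk
  exact ⟨k, fun w => by rw [← hk]; rfl⟩

theorem BalancedFamily.injective (hN : N ≠ 0) {L : W →ₗ[ZMod 2] (D → ZMod 2)}
    (hL : BalancedFamily N e L) : Function.Injective L := by
  rw [injective_iff_map_eq_zero]
  intro w hw
  rw [← Module.forall_dual_apply_eq_zero_iff (ZMod 2)]
  intro h
  obtain ⟨k, hk⟩ := hL.exists_coord hN h
  rw [← hk, hw]; rfl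

theorem BalancedFamily.reindex {L L' : W →ₗ[ZMod 2] (D → ZMod 2)} (hL : BalancedFamily N e L)
    (σ : Equiv.Perm D) (h : ∀ w k, L' w k = L w (σ k)) : BalancedFamily N e L' := by
  classical
  intro g
  rw [← hL g]
  congr 1
  refine Finset.card_equiv σ fun k => ?_
  have : coordFunctional L' k = coordFunctional L (σ k) := by
    ext w; exact h w k
  simp [this]

/-- A word is complementary to `L` if adjoining it to `L` gives a balanced family. -/
def Complementary (N e : ℕ) (L : W →ₗ[ZMod 2] (D → ZMod 2)) (s : D → ZMod 2) : Prop :=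
  BalancedFamily N e (adjoinWord L s)

theorem coordFunctional_adjoinWord_eq_iff (L : W →ₗ[ZMod 2] (D → ZMod 2)) (s : D → ZMod 2) (k : D)
    (h : Module.Dual (ZMod 2) (W × ZMod 2)) :
    coordFunctional (adjoinWord L s) k = h ↔
      coordFunctional L k = h.comp (LinearMap.inl _ _ _) ∧ s k = h (0, 1) := by
  constructor
  · rintro rfl
    refine ⟨?_, by simp⟩
    ext w; simp
  · rintro ⟨h1, h2⟩
    ext w
    · simpa using congrArg (fun g => g w) h1
    · simp [h2]

/-- A fibre has `2 * m` elements, plus `e` over zero. A complementary word takes the value `1` at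
exactly `m` places of each fibre, so values may be prescribed as long as at most `m` ones and at
most `m` zeros are demanded per fibre. -/
theorem BalancedFamily.exists_complementary {L : W →ₗ[ZMod 2] (D → ZMod 2)} (hL : BalancedFamily N e L)
    {m : ℕ} (hm : N = m * 2 ^ (Module.finrank (ZMod 2) W + 1)) (A B : Finset D)
    (hAB : Disjoint A B)
    (hA : ∀ k ∈ A, ∀ S ⊆ A, (∀ l ∈ S, coordFunctional L l = coordFunctional L k) → S.card ≤ m)
    (hB : ∀ k ∈ B, ∀ S ⊆ B, (∀ l ∈ S, coordFunctional L l = coordFunctional L k) → S.card ≤ m) :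
    ∃ s, Complementary N e L s ∧ (∀ k ∈ A, s k = 1) ∧ (∀ k ∈ B, s k = 0) := by
  classical
  let F : Module.Dual (ZMod 2) W → Finset D := fun h =>
    Finset.univ.filter fun k => coordFunctional L k = h
  have hpos : 0 < 2 ^ Module.finrank (ZMod 2) W := by positivity
  have hF : ∀ h, (F h).card = 2 * m + if h = 0 then e else 0 := by
    intro h
    apply Nat.eq_of_mul_eq_mul_right hpos
    have := hL h
    rw [show (F h).card * 2 ^ Module.finrank (ZMod 2) W = _ from this, hm]
    split_ifs <;> ring
  -- `U` is the support of the new word in the fibre over `h`; the surplus over `h = 0` stays among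
  -- the zeros.
  have hU : ∀ h, ∃ U : Finset D, A ∩ F h ⊆ U ∧ U ⊆ F h \ B ∧ U.card = m := by
    intro h
    apply Finset.exists_subsuperset_card_eq
    · intro k hk
      rw [Finset.mem_inter] at hk
      exact Finset.mem_sdiff.mpr ⟨hk.2, Finset.disjoint_left.mp hAB hk.1⟩
    · rcases (A ∩ F h).eq_empty_or_nonempty with h0 | ⟨k, hk⟩
      · simp [h0]
      · have hk' := Finset.mem_inter.mp hk
        refine hA k hk'.1 _ Finset.inter_subset_left fun l hl => ?_
        have hl' := (Finset.mem_inter.mp hl).2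
        have hk'' := hk'.2
        simp only [F, Finset.mem_filter, Finset.mem_univ, true_and] at hl' hk''
        rw [hl', hk'']
    · have h1 : (B ∩ F h).card ≤ m := by
        rcases (B ∩ F h).eq_empty_or_nonempty with h0 | ⟨k, hk⟩
        · simp [h0]
        · have hk' := Finset.mem_inter.mp hk
          refine hB k hk'.1 _ Finset.inter_subset_left fun l hl => ?_
          have hl' := (Finset.mem_inter.mp hl).2
          have hk'' := hk'.2
          simp only [F, Finset.mem_filter, Finset.mem_univ, true_and] at hl' hk''
          rw [hl', hk'']
      have h2 := Finset.card_sdiff_add_card_inter (F h) B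
      rw [Finset.inter_comm, hF h] at h2
      omega
  choose U hAU hUB hUm using hU
  have hUF : ∀ h, U h ⊆ F h := fun h => (hUB h).trans Finset.sdiff_subset
  let s : D → ZMod 2 := fun k => if k ∈ U (coordFunctional L k) then 1 else 0
  refine ⟨s, ?_, ?_, ?_⟩
  · intro h
    rw [Module.finrank_prod, Module.finrank_self]
    set h' := h.comp (LinearMap.inl _ _ _) with hh'
    have hcard : ∀ t : ZMod 2, h (0, 1) = t →
      (Finset.univ.filter fun k => coordFunctional (adjoinWord L s) k = h).card =
        m + if t = 0 ∧ h' = 0 then e else 0 := by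
      intro t ht
      simp only [coordFunctional_adjoinWord_eq_iff, ht, ← hh']
      rcases ZMod.eq_zero_or_one_of_two t with rfl | rfl
      · have : (Finset.univ.filter fun k => coordFunctional L k = h' ∧ s k = 0) = F h' \ U h' := by
          ext k
          simp only [Finset.mem_filter, Finset.mem_univ, true_and, F, Finset.mem_sdiff, s]
          constructor
          · rintro ⟨h1, h2⟩
            exact ⟨h1, fun h3 => by simp [h1, h3] at h2⟩
          · rintro ⟨h1, h2⟩
            exact ⟨h1, by simp [h1, h2]⟩
        rw [this, Finset.card_sdiff_of_subset (hUF _), hF, hUm]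
        simp only [true_and]
        omega
      · have : (Finset.univ.filter fun k => coordFunctional L k = h' ∧ s k = 1) = U h' := by
          ext k
          simp only [Finset.mem_filter, Finset.mem_univ, true_and, s]
          constructor
          · rintro ⟨h1, h2⟩
            by_contra h3
            simp [h1, h3] at h2
          · intro h2
            have h3 := hUF _ h2
            simp only [Finset.mem_filter, Finset.mem_univ, true_and, F] at h3
            exact ⟨h3, by simp [h3, h2]⟩
        rw [this, hUm]
        simp
    rw [hcard _ rfl, hm]
    have hiff : (h (0, 1) = 0 ∧ h' = 0) ↔ h = 0 := by
      constructor
      · rintro ⟨h1, h2⟩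
        ext w
        · exact congrArg (fun g => g w) h2
        · simpa using h1
      · rintro rfl
        simp [hh']
    simp only [hiff]
    split_ifs <;> ring
  · intro k hk
    have : k ∈ U (coordFunctional L k) := hAU _ (by simp [hk, F])
    simp [s, this]
  · intro k hk
    have : k ∉ U (coordFunctional L k) := fun h => (Finset.mem_sdiff.mp (hUB _ h)).2 hk
    simp [s, this]

theorem Complementary.balancedFamily {L : W →ₗ[ZMod 2] (D → ZMod 2)} {s : D → ZMod 2}
    (hs : Complementary N e L s) : BalancedFamily N e L := by
  have : L = (adjoinWord L s).comp (LinearMap.inl _ _ _) := by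
    ext w k; simp
  rw [this]
  exact BalancedFamily.comp hs LinearMap.inl_injective

/-- Two words that can be adjoined to `L` simultaneously. -/
def JointlyComplementary (N e : ℕ) (L : W →ₗ[ZMod 2] (D → ZMod 2)) (s u : D → ZMod 2) : Prop :=
  Complementary N e (adjoinWord L s) u

theorem JointlyComplementary.complementary_right {L : W →ₗ[ZMod 2] (D → ZMod 2)}
    {s u : D → ZMod 2} (h : JointlyComplementary N e L s u) : Complementary N e L u := by
  have : adjoinWord L u = (adjoinWord (adjoinWord L s) u).comp
      ((LinearMap.inl (ZMod 2) W (ZMod 2)).prodMap LinearMap.id) := by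
    refine LinearMap.ext fun ⟨w, t⟩ => funext fun k => ?_
    simp
  rw [Complementary, this]
  refine BalancedFamily.comp h ?_
  rintro ⟨w, t⟩ ⟨w', t'⟩ h
  simpa using h

open Classical in
-- In a fibre of `L` where the two words differ, their supports are distinct sets of equal size, so
-- each contains a point outside the other.
theorem exists_swap_coords {L : W →ₗ[ZMod 2] (D → ZMod 2)} {s s' : D → ZMod 2}
    (hs : Complementary N e L s) (hs' : Complementary N e L s') (hne : s ≠ s') :
    ∃ a b, coordFunctional L a = coordFunctional L b ∧ s a = 1 ∧ s' a = 0 ∧ s b = 0 ∧ s' b = 1 := by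
  obtain ⟨π, hπ⟩ := BalancedFamily.exists_perm hs hs'
  obtain ⟨k, hk⟩ := Function.ne_iff.mp hne
  set X : Finset D := Finset.univ.filter fun l => coordFunctional L l = coordFunctional L k ∧ s l = 1
    with hX
  set X' : Finset D :=
    Finset.univ.filter fun l => coordFunctional L l = coordFunctional L k ∧ s' l = 1 with hX'
  have hcard : X.card = X'.card := by
    refine Finset.card_equiv π fun l => ?_
    have h1 : coordFunctional L (π l) = coordFunctional L l := by
      ext w
      simpa using hπ (w, 0) l
    have h2 : s' (π l) = s l := by simpa using hπ (0, 1) l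
    simp [hX, hX', h1, h2]
  have hXX' : X ≠ X' := by
    intro h
    have := Finset.ext_iff.mp h k
    simp only [hX, hX', Finset.mem_filter, Finset.mem_univ, true_and] at this
    apply hk
    rcases ZMod.eq_zero_or_one_of_two (s k) with h0 | h0 <;>
      rcases ZMod.eq_zero_or_one_of_two (s' k) with h1 | h1 <;> simp_all
  obtain ⟨a, haX, haX'⟩ := Finset.not_subset.mp fun h =>
    hXX' (Finset.eq_of_subset_of_card_le h hcard.ge)
  obtain ⟨b, hbX', hbX⟩ := Finset.not_subset.mp fun h =>
    hXX' (Finset.eq_of_subset_of_card_le h hcard.le).symm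
  simp only [hX, hX', Finset.mem_filter, Finset.mem_univ, true_and] at haX haX' hbX hbX'
  refine ⟨a, b, haX.1.trans hbX'.1.symm, haX.2, ?_, ?_, hbX'.2⟩
  · exact (ZMod.eq_zero_or_one_of_two _).resolve_right fun h => haX' ⟨haX.1, h⟩
  · exact (ZMod.eq_zero_or_one_of_two _).resolve_right fun h => hbX ⟨hbX'.1, h⟩

open Classical in
theorem exists_jointlyComplementary_swap {L : W →ₗ[ZMod 2] (D → ZMod 2)} {m : ℕ} (hm0 : 1 ≤ m)
    (hm : N = m * 2 ^ (Module.finrank (ZMod 2) W + 2)) {s : D → ZMod 2}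
    (hs : Complementary N e L s) {a b : D} (hab : coordFunctional L a = coordFunctional L b)
    (ha : s a = 1) (hb : s b = 0) :
    ∃ u, JointlyComplementary N e L s u ∧
      JointlyComplementary N e L (s ∘ Equiv.swap a b) u := by
  -- Adjoining `s` separates `a` from `b`, so `{a, b}` meets each fibre of the larger family at most
  -- once and `1 ≤ m` suffices.
  obtain ⟨u, hu, hA, -⟩ := BalancedFamily.exists_complementary (m := m) hs
    (by rw [Module.finrank_prod, Module.finrank_self, hm]) {a, b} ∅ (by simp) (by
      intro k _ S hS hl
      refine le_trans (Finset.card_le_one.mpr fun x hx y hy => ?_) hm0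
      have h1 : s x = s y := by
        simpa using congrArg (fun g => g (0, 1)) ((hl x hx).trans (hl y hy).symm)
      have hx' := hS hx
      have hy' := hS hy
      simp only [Finset.mem_insert, Finset.mem_singleton] at hx' hy'
      rcases hx' with rfl | rfl <;> rcases hy' with rfl | rfl
      · rfl
      · exact absurd (ha.symm.trans (h1.trans hb)) one_ne_zero
      · exact absurd (ha.symm.trans (h1.symm.trans hb)) one_ne_zero
      · rfl) (by simp)
  refine ⟨u, hu, BalancedFamily.reindex hu (Equiv.swap a b) ?_⟩
  have hua : u a = 1 := hA a (by simp)
  have hub : u b = 1 := hA b (by simp)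
  rintro ⟨⟨w, t⟩, t'⟩ k
  have hL : L w a = L w b := congrArg (fun g => g w) hab
  have h1 : L w (Equiv.swap a b k) = L w k := by
    rw [Equiv.swap_apply_def]
    split_ifs with h1 h2
    · rw [h1, hL]
    · rw [h2, hL]
    · rfl
  have h2 : u (Equiv.swap a b k) = u k := by
    rw [Equiv.swap_apply_def]
    split_ifs with h1 h2
    · rw [h1, hua, hub]
    · rw [h2, hua, hub]
    · rfl
  simp [h1, h2]

/-- Induction on the Hamming distance: one swap makes `s` agree with `s'` at both `a` and `b` and
costs two steps through `u`. -/
theorem Complementary.eqvGen_jointlyComplementary {L : W →ₗ[ZMod 2] (D → ZMod 2)} {m : ℕ}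
    (hm0 : 1 ≤ m)
    (hm : N = m * 2 ^ (Module.finrank (ZMod 2) W + 2)) {s s' : D → ZMod 2}
    (hs : Complementary N e L s) (hs' : Complementary N e L s') :
    Relation.EqvGen (JointlyComplementary N e L) s s' := by
  classical
  induction hδ : (Finset.univ.filter fun k => s k ≠ s' k).card using Nat.strong_induction_on
    generalizing s with
  | _ δ ih =>
    by_cases hne : s = s'
    · rw [hne]; exact Relation.EqvGen.refl _
    obtain ⟨a, b, hab, ha, ha', hb, hb'⟩ := exists_swap_coords hs hs' hne
    obtain ⟨u, hu, hu'⟩ := exists_jointlyComplementary_swap hm0 hm hs hab ha hb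
    refine (Relation.EqvGen.rel _ _ hu).trans _ _ _ (((Relation.EqvGen.rel _ _ hu').symm).trans _ _ _
      (ih _ ?_ (Complementary.balancedFamily hu') rfl))
    rw [← hδ]
    apply Finset.card_lt_card
    refine Finset.ssubset_iff_subset_ne.mpr ⟨fun k hk => ?_, fun h => ?_⟩
    · simp only [Finset.mem_filter, Finset.mem_univ, true_and, Function.comp_apply] at hk ⊢
      rw [Equiv.swap_apply_def] at hk
      split_ifs at hk with h1 h2
      · rw [h1, ha', hb] at hk; exact absurd rfl hk
      · rw [h2, ha, hb'] at hk; exact absurd rfl hk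
      · exact hk
    · have := (Finset.ext_iff.mp h a).mpr (by simp [ha, ha'])
      simp [hb, ha'] at this

end Balanced

/-! ### Column elimination within blocks -/

section Elimination

set_option linter.unusedSectionVars false

variable {D K Λ : Type*} [Fintype D] [DecidableEq D] [Field K]

open Matrix

/-- A square matrix acts trivially outside `A` if its columns outside `A` are those of `1`. -/
def ColsTrivialOff (A : Finset D) (T : Matrix D D K) : Prop :=
  ∀ l ∉ A, ∀ k, T k l = (1 : Matrix D D K) k l

/-- A matrix respects the blocks given by `c` if its entries between different blocks vanish. -/
def RespectsBlocks (c : D → Λ) (T : Matrix D D K) : Prop :=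
  ∀ k l, T k l ≠ 0 → c k = c l

theorem RespectsBlocks.mul {c : D → Λ} {S T : Matrix D D K} (hS : RespectsBlocks c S)
    (hT : RespectsBlocks c T) : RespectsBlocks c (S * T) := by
  intro k l h
  rw [Matrix.mul_apply] at h
  obtain ⟨j, -, hj⟩ := Finset.exists_ne_zero_of_sum_ne_zero h
  exact (hS k j (left_ne_zero_of_mul hj)).trans (hT j l (right_ne_zero_of_mul hj))

theorem respectsBlocks_one (c : D → Λ) : RespectsBlocks c (1 : Matrix D D K) := by
  intro k l h
  by_contra hc
  exact h (Matrix.one_apply_ne fun e => hc (by rw [e]))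

theorem ColsTrivialOff.mul {A : Finset D} {S T : Matrix D D K} (hS : ColsTrivialOff A S)
    (hT : ColsTrivialOff A T) : ColsTrivialOff A (S * T) := by
  intro l hl k
  rw [Matrix.mul_apply, Finset.sum_congr rfl (fun j _ => by rw [hT l hl j]),
    ← Matrix.mul_apply, Matrix.mul_one, hS l hl k]

/-- The matrix `1` with its column `a` replaced by `v`. -/
def oneUpdateCol (a : D) (v : D → K) : Matrix D D K := (1 : Matrix D D K).updateCol a v

theorem oneUpdateCol_apply (a : D) (v : D → K) (k l : D) :
    oneUpdateCol a v k l = if l = a then v k else (1 : Matrix D D K) k l := by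
  simp [oneUpdateCol, Matrix.updateCol_apply]

theorem colsTrivialOff_oneUpdateCol {A : Finset D} {a : D} (ha : a ∈ A) (v : D → K) :
    ColsTrivialOff A (oneUpdateCol a v) := by
  intro l hl k
  rw [oneUpdateCol_apply, if_neg]
  rintro rfl
  exact hl ha

theorem mul_oneUpdateCol_apply (T : Matrix D D K) (a : D) (v : D → K) (k l : D) :
    (T * oneUpdateCol a v) k l = if l = a then (T *ᵥ v) k else T k l := by
  rw [Matrix.mul_apply]
  split_ifs with h
  · simp [oneUpdateCol_apply, h, Matrix.mulVec, dotProduct]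
  · simp only [oneUpdateCol_apply, h, if_false]
    rw [← Matrix.mul_apply, Matrix.mul_one]

theorem oneUpdateCol_mul_oneUpdateCol (a : D) (v w : D → K) :
    oneUpdateCol a v * oneUpdateCol a w =
      oneUpdateCol a (fun k => (if k = a then 0 else w k) + w a * v k) := by
  ext k l
  rw [mul_oneUpdateCol_apply, oneUpdateCol_apply, oneUpdateCol_apply]
  split_ifs with h1 h2
  · subst h2 h1
    simp only [Matrix.mulVec, dotProduct, oneUpdateCol_apply]
    rw [Finset.sum_eq_single l]
    · simp [mul_comm]
    · intro b _ hb
      simp [hb, hb.symm]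
    · simp
  · subst h1
    simp only [Matrix.mulVec, dotProduct, oneUpdateCol_apply]
    rw [Finset.sum_eq_add k l h2]
    · simp [h2, mul_comm]
    · rintro b - ⟨hb, hb'⟩
      simp [hb', Ne.symm hb]
    · simp
    · simp
  · rfl

theorem oneUpdateCol_eq_one (a : D) : oneUpdateCol a (fun k => (1 : Matrix D D K) k a) = 1 := by
  ext k l
  rw [oneUpdateCol_apply]
  split_ifs with h
  · rw [h]
  · rfl

/-- The column of the inverse of `oneUpdateCol a v`. -/
def pivotInv (a : D) (v : D → K) : D → K := fun k => if k = a then (v a)⁻¹ else -(v k * (v a)⁻¹)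

theorem oneUpdateCol_mul_pivotInv {a : D} {v : D → K} (ha : v a ≠ 0) :
    oneUpdateCol a v * oneUpdateCol a (pivotInv a v) = 1 := by
  rw [oneUpdateCol_mul_oneUpdateCol, ← oneUpdateCol_eq_one a]
  congr 1
  ext k
  by_cases h : k = a
  · subst h; simp [pivotInv, ha]
  · simp [pivotInv, h]; ring

theorem respectsBlocks_oneUpdateCol {c : D → Λ} {a : D} {v : D → K}
    (hv : ∀ k, v k ≠ 0 → c k = c a) : RespectsBlocks c (oneUpdateCol a v) := by
  intro k l h
  rw [oneUpdateCol_apply] at h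
  split_ifs at h with h1
  · rw [h1]; exact hv k h
  · exact respectsBlocks_one c k l h

/-- Gaussian elimination by columns: an invertible matrix respecting a block structure is a product
of such matrices that differ from `1` in a single column. -/
theorem elimination {c : D → Λ} {Φ : Matrix D D K → Prop} (h1 : Φ 1)
    (hmul : ∀ S T, Φ S → Φ T → Φ (S * T)) (A₀ : Finset D)
    (hcol : ∀ a ∈ A₀, ∀ v : D → K, v a ≠ 0 → (∀ k, v k ≠ 0 → c k = c a) → Φ (oneUpdateCol a v))
    (T : Matrix D D K) (hT : IsUnit T) (hc : RespectsBlocks c T) (hA : ColsTrivialOff A₀ T) :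
    Φ T := by
  suffices H : ∀ A ⊆ A₀, ∀ T : Matrix D D K, IsUnit T → RespectsBlocks c T →
      ColsTrivialOff A T → Φ T from H A₀ subset_rfl T hT hc hA
  intro A
  induction A using Finset.induction_on with
  | empty =>
    intro _ T _ _ hA
    have : T = 1 := by
      ext k l
      exact hA l (by simp) k
    rwa [this]
  | insert a A ha ih =>
    intro hAA₀ T hT hc hA
    have haA₀ : a ∈ A₀ := hAA₀ (Finset.mem_insert_self _ _)
    have key : ∀ T : Matrix D D K, IsUnit T → RespectsBlocks c T →
        ColsTrivialOff (insert a A) T → T a a ≠ 0 → Φ T := by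
      intro T hT hc hA hne
      set v : D → K := fun k => T k a with hv
      have hva : v a ≠ 0 := hne
      have hvc : ∀ k, v k ≠ 0 → c k = c a := fun k hk => hc k a hk
      -- Splitting off the column `a` as a left factor leaves a matrix whose column `a` is trivial,
      -- to which the induction hypothesis applies.
      have e1 := oneUpdateCol_mul_pivotInv hva
      have e2 := mul_eq_one_comm.mp e1
      have hT' : T = oneUpdateCol a v * (oneUpdateCol a (pivotInv a v) * T) := by
        rw [← Matrix.mul_assoc, e1, Matrix.one_mul]
      rw [hT']
      refine hmul _ _ (hcol a haA₀ v hva hvc) (ih ((Finset.subset_insert _ _).trans hAA₀) _ ?_ ?_ ?_)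
      · exact (IsUnit.of_mul_eq_one _ e2).mul hT
      · refine (respectsBlocks_oneUpdateCol fun k hk => ?_).mul hc
        by_cases hka : k = a
        · rw [hka]
        · simp only [pivotInv, hka, if_false, ne_eq, neg_eq_zero] at hk
          exact hvc k (left_ne_zero_of_mul hk)
      · intro l hl k
        by_cases hla : l = a
        · subst hla
          rw [← e2, Matrix.mul_apply, Matrix.mul_apply]
          refine Finset.sum_congr rfl fun x _ => ?_
          rw [oneUpdateCol_apply l v, if_pos rfl]
        · exact ((colsTrivialOff_oneUpdateCol (Finset.mem_insert_self a A) _).mul hA) l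
            (by simp [hla, hl]) k
    by_cases hne : T a a = 0
    -- With a zero pivot, adding the column `b` to the column `a` makes it nonzero; `T a b ≠ 0`
    -- forces `b` into the block of `a`.
    · obtain ⟨b, hb⟩ : ∃ b, T a b ≠ 0 := by
        by_contra! hzero
        have : T.det = 0 := Matrix.det_eq_zero_of_row_eq_zero a hzero
        rw [Matrix.isUnit_iff_isUnit_det, this] at hT
        exact not_isUnit_zero hT
      have hba : b ≠ a := fun h => hb (h ▸ hne)
      let u : K → D → K := fun t k => if k = a then 1 else if k = b then t else 0
      have hu : oneUpdateCol a (u 1) * oneUpdateCol a (u (-1)) = (1 : Matrix D D K) := by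
        rw [oneUpdateCol_mul_oneUpdateCol, ← oneUpdateCol_eq_one a]
        congr 1
        ext k
        by_cases h : k = a
        · subst h; simp [u]
        · by_cases h' : k = b <;> simp [u, h, h', hba]
      have huc : ∀ t k, u t k ≠ 0 → c k = c a := by
        intro t k hk
        by_cases h : k = a
        · rw [h]
        · by_cases h' : k = b
          · rw [h']; exact (hc a b hb).symm
          · simp [u, h, h'] at hk
      have hua : ∀ t, u t a ≠ 0 := by simp [u]
      have hT' : T = (T * oneUpdateCol a (u 1)) * oneUpdateCol a (u (-1)) := by
        rw [Matrix.mul_assoc, hu, Matrix.mul_one]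
      rw [hT']
      refine hmul _ _ (key _ ?_ ?_ ?_ ?_) (hcol a haA₀ _ (hua _) (huc _))
      · exact hT.mul (IsUnit.of_mul_eq_one _ hu)
      · exact hc.mul (respectsBlocks_oneUpdateCol (huc _))
      · exact hA.mul (colsTrivialOff_oneUpdateCol (Finset.mem_insert_self a A) _)
      · rw [mul_oneUpdateCol_apply, if_pos rfl]
        simp only [Matrix.mulVec, dotProduct, u]
        rw [Finset.sum_eq_add a b hba.symm]
        · simpa [hne, hba] using hb
        · rintro k - ⟨hk, hk'⟩
          simp [hk, hk']
        · simp
        · simp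
    · exact key T hT hc hA hne

/-- A matrix differing from `1` in the column `a` only is a product of a diagonal matrix and of
transvections. -/
theorem oneUpdateCol_of_transvections {Φ : Matrix D D K → Prop}
    (hmul : ∀ S T, Φ S → Φ T → Φ (S * T)) (a : D) (v : D → K) (hva : v a ≠ 0)
    (hdiag : Φ (Matrix.diagonal fun k => if k = a then v a else 1))
    (htrans : ∀ k, k ≠ a → v k ≠ 0 → ∀ t, Φ (oneUpdateCol a fun j =>
      if j = a then 1 else if j = k then t else 0)) :
    Φ (oneUpdateCol a v) := by
  have H : ∀ A : Finset D, Φ (oneUpdateCol a fun j => if j = a then v a else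
      if j ∈ A then v j else 0) := by
    intro A
    induction A using Finset.induction_on with
    | empty =>
      convert hdiag using 1
      ext k l
      rw [oneUpdateCol_apply, Matrix.diagonal_apply]
      by_cases h : l = a <;> by_cases h' : k = l <;> simp_all [Matrix.one_apply]
    | insert k A hk ih =>
      by_cases hka : k = a
      · convert ih using 4 with j
        rename_i hja
        · have : j ≠ k := fun h => hja (h.trans hka)
          simp [this]
      by_cases hvk : v k = 0
      · convert ih using 4 with j
        by_cases hjk : j = k
        · simp [hjk, hvk, hk]
        · simp [hjk]
      -- The transvection acts on a column whose entry at `a` is already `v a`, hence the quotient.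
      convert hmul _ _ (htrans k hka hvk (v k / v a)) ih using 1
      rw [oneUpdateCol_mul_oneUpdateCol]
      congr 1
      ext j
      by_cases hja : j = a
      · simp [hja]
      · by_cases hjk : j = k
        · subst hjk
          simp [hja, hk, mul_div_cancel₀ _ hva]
        · simp [hja, hjk]
  convert H Finset.univ using 2
  ext j
  by_cases hja : j = a <;> simp [hja]

end Elimination

/-! ### Diagonal words in a frame -/

section Frames

set_option linter.unusedSectionVars false

open Matrix

variable {D K W : Type*} [Fintype D] [DecidableEq D] [Field K] [Algebra (ZMod 2) K]
  [AddCommGroup W] [Module (ZMod 2) W]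

/-- The diagonal matrix of a binary word. -/
def wordDiag (K : Type*) [Field K] [Algebra (ZMod 2) K] (s : D → ZMod 2) : Matrix D D K :=
  Matrix.diagonal fun k => algebraMap (ZMod 2) K (s k)

/-- The linear map `w ↦ P * diag (L w) * Q`. -/
def framedMap (P Q : Matrix D D K) (L : W →ₗ[ZMod 2] (D → ZMod 2)) :
    W →ₗ[ZMod 2] Matrix D D K where
  toFun w := P * wordDiag K (L w) * Q
  map_add' v w := by
    have : wordDiag K (L (v + w)) = wordDiag K (L v) + wordDiag K (L w) := by
      simp [wordDiag, Matrix.diagonal_add]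
    rw [this, Matrix.mul_add, Matrix.add_mul]
  map_smul' c w := by
    rcases ZMod.eq_zero_or_one_of_two c with rfl | rfl
    · simp [wordDiag]
    · simp

theorem framedMap_apply (P Q : Matrix D D K) (L : W →ₗ[ZMod 2] (D → ZMod 2)) (w : W) :
    framedMap P Q L w = P * wordDiag K (L w) * Q := rfl

theorem wordDiag_injective : Function.Injective (wordDiag K : (D → ZMod 2) → Matrix D D K) :=
  fun _ _ h => funext fun k => (algebraMap (ZMod 2) K).injective
    (congrFun (Matrix.diagonal_injective h) k)

theorem framedMap_injective {P Q : Matrix D D K} (hP : IsUnit P) (hQ : IsUnit Q)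
    {L : W →ₗ[ZMod 2] (D → ZMod 2)} (hL : Function.Injective L) :
    Function.Injective (framedMap P Q L) := fun _ _ h =>
  hL (wordDiag_injective (hP.mul_left_cancel (hQ.mul_right_cancel h)))

theorem framedMap_reindex (P Q : Matrix D D K) {L L' : W →ₗ[ZMod 2] (D → ZMod 2)}
    {π : Equiv.Perm D} (h : ∀ w k, L' w (π k) = L w k) :
    framedMap P Q L = framedMap (P.submatrix id π.symm) (Q.submatrix π.symm id) L' := by
  refine LinearMap.ext fun w => ?_
  have : wordDiag K (L' w) = (wordDiag K (L w)).submatrix π.symm π.symm := by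
    rw [wordDiag, wordDiag, Matrix.submatrix_diagonal_equiv]
    congr 1
    ext k
    simp [← h w]
  rw [framedMap_apply, framedMap_apply, this, Matrix.submatrix_mul_equiv,
    Matrix.submatrix_mul_equiv, Matrix.submatrix_id_id]

theorem isUnit_submatrix_id_equiv {P : Matrix D D K} (hP : IsUnit P) (π : Equiv.Perm D) :
    IsUnit (P.submatrix id π) := (Matrix.isUnit_submatrix_equiv (Equiv.refl D) π).mpr hP

theorem isUnit_submatrix_equiv_id {P : Matrix D D K} (hP : IsUnit P) (π : Equiv.Perm D) :
    IsUnit (P.submatrix π id) := (Matrix.isUnit_submatrix_equiv π (Equiv.refl D)).mpr hP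

theorem framedMap_comp {U : Type*} [AddCommGroup U] [Module (ZMod 2) U] (P Q : Matrix D D K)
    (L : W →ₗ[ZMod 2] (D → ZMod 2)) (ι : U →ₗ[ZMod 2] W) :
    framedMap P Q (L.comp ι) = (framedMap P Q L).comp ι := rfl

theorem LinearIndependent.exists_extend_fin {n m : ℕ} (hmn : m ≤ n) {e : Fin m → Fin n → K}
    (he : LinearIndependent K e) :
    ∃ E : Fin n → Fin n → K, LinearIndependent K E ∧ ∀ k, E (Fin.castLE hmn k) = e k := by
  obtain ⟨j, hj⟩ := Nat.exists_eq_add_of_le hmn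
  induction j generalizing m with
  | zero =>
    obtain rfl : n = m := hj
    exact ⟨e, he, fun k => rfl⟩
  | succ j ih =>
    obtain ⟨v, hv⟩ := exists_linearIndependent_snoc_of_lt_finrank he
      (by rw [Module.finrank_fin_fun]; omega)
    obtain ⟨E, hE, hEv⟩ := ih (by omega) hv (by omega)
    refine ⟨E, hE, fun k => ?_⟩
    have := hEv k.castSucc
    rw [Fin.snoc_castSucc] at this
    exact this

end Frames

/-! ### Faces as framed balanced families -/

section TopFaces

theorem balancedFamily_iff {D W : Type*} [Fintype D] [AddCommGroup W] [Module (ZMod 2) W]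
    [DecidableEq (Module.Dual (ZMod 2) W)] {N e : ℕ} {L : W →ₗ[ZMod 2] (D → ZMod 2)} :
    BalancedFamily N e L ↔ ∀ h : Module.Dual (ZMod 2) W,
      (Finset.univ.filter fun k => coordFunctional L k = h).card *
        2 ^ Module.finrank (ZMod 2) W =
      N + if h = 0 then e * 2 ^ Module.finrank (ZMod 2) W else 0 := by
  unfold BalancedFamily
  refine forall_congr' fun h => ?_
  congr!

variable {r b n : ℕ}

/-- The Hadamard code, with its words extended by zeros to length `n`. -/
noncomputable def hadamardWords (r n : ℕ) :
    (Fin (r + 1) → ZMod 2) →ₗ[ZMod 2] (Fin n → ZMod 2) :=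
  LinearMap.pi fun k => if h : k.1 < 2 ^ (r + 1) - 1 then
    (LinearMap.proj ⟨k.1, h⟩).comp (hadamardGen r).mulVecLin else 0

theorem sum_castLE_of_eq_zero {M : Type*} [AddCommMonoid M] {m n : ℕ} (h : m ≤ n) (F : Fin n → M)
    (hF : ∀ k : Fin n, m ≤ k.1 → F k = 0) : ∑ k, F k = ∑ k : Fin m, F (Fin.castLE h k) := by
  obtain ⟨j, rfl⟩ := Nat.exists_eq_add_of_le h
  rw [Fin.sum_univ_add, Finset.sum_eq_zero (s := (Finset.univ : Finset (Fin j))), add_zero]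
  · rfl
  · intro k _
    exact hF _ (by simp)

theorem hadamardImage_eq_range (hn : 2 ^ (r + 1) - 1 ≤ n)
    (e f : Fin (2 ^ (r + 1) - 1) → (Fin n → Fq b)) (P Q : Matrix (Fin n) (Fin n) (Fq b))
    (hP : ∀ k i, P i (Fin.castLE hn k) = e k i) (hQ : ∀ k i, Q (Fin.castLE hn k) i = f k i) :
    hadamardImage r b n e f = LinearMap.range (framedMap P Q (hadamardWords r n)) := by
  unfold hadamardImage
  congr 1
  refine LinearMap.ext fun c => ?_
  rw [framedMap_apply]
  ext i j
  rw [Matrix.mul_apply, sum_castLE_of_eq_zero hn]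
  · simp only [LinearMap.comp_apply, Fintype.linearCombination_apply, Matrix.sum_apply]
    refine Finset.sum_congr rfl fun k _ => ?_
    rw [wordDiag, Matrix.mul_diagonal, hP, hQ]
    simp [hadamardWords, Matrix.vecMulVec_apply, Algebra.smul_def]
    ring
  · intro k hk
    rw [wordDiag, Matrix.mul_diagonal]
    simp [hadamardWords, not_lt.mpr hk]

theorem eq_of_testBit_rev {x y : ℕ} (hx : x < 2 ^ (r + 1)) (hy : y < 2 ^ (r + 1))
    (h : ∀ j : Fin (r + 1), x.testBit (r - j.1) = y.testBit (r - j.1)) : x = y := by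
  refine Nat.eq_of_testBit_eq fun i => ?_
  by_cases hi : i < r + 1
  · have := h ⟨r - i, by omega⟩
    simpa [Nat.sub_sub_self (Nat.lt_succ_iff.mp hi)] using this
  · have hle : 2 ^ (r + 1) ≤ 2 ^ i := Nat.pow_le_pow_right two_pos (not_lt.mp hi)
    rw [Nat.testBit_lt_two_pow (hx.trans_le hle), Nat.testBit_lt_two_pow (hy.trans_le hle)]

theorem hadamardGen_row_injective (r : ℕ) : Function.Injective (hadamardGen r) := by
  intro k l hkl
  have := eq_of_testBit_rev (r := r) (x := 2 ^ (r + 1) - (k.1 + 1))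
    (y := 2 ^ (r + 1) - (l.1 + 1)) (by have := k.2; omega) (by have := l.2; omega) fun j => by
      have := congrFun hkl j
      simp only [hadamardGen, Matrix.of_apply] at this
      split_ifs at this <;> simp_all
  ext
  have := k.2
  have := l.2
  omega

theorem hadamardGen_row_ne_zero (k : Fin (2 ^ (r + 1) - 1)) : hadamardGen r k ≠ 0 := by
  intro h
  have := eq_of_testBit_rev (r := r) (x := 2 ^ (r + 1) - (k.1 + 1)) (y := 0)
    (by have := k.2; omega) (by positivity) fun j => by
      have := congrFun h j
      simp only [hadamardGen, Matrix.of_apply, Pi.zero_apply, ite_eq_right_iff, one_ne_zero,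
        imp_false] at this
      simpa using this
  have := k.2
  omega

/-- The functional given by a row of the Hadamard generator matrix. -/
noncomputable def hadamardFunctional (r : ℕ) (k : Fin (2 ^ (r + 1) - 1)) :
    Module.Dual (ZMod 2) (Fin (r + 1) → ZMod 2) :=
  (LinearMap.proj k).comp (hadamardGen r).mulVecLin

theorem hadamardFunctional_single (k : Fin (2 ^ (r + 1) - 1)) (j : Fin (r + 1)) :
    hadamardFunctional r k (Pi.single j 1) = hadamardGen r k j := by
  simp [hadamardFunctional]

theorem hadamardFunctional_ne_zero (k : Fin (2 ^ (r + 1) - 1)) : hadamardFunctional r k ≠ 0 := by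
  intro h
  refine hadamardGen_row_ne_zero k (funext fun j => ?_)
  rw [← hadamardFunctional_single, h]
  rfl

/-- The rows are binary expansions of distinct numbers, and there are as many of them as nonzero
functionals. -/
theorem hadamardFunctional_bijective (r : ℕ) :
    Function.Bijective fun k => (⟨hadamardFunctional r k, hadamardFunctional_ne_zero k⟩ :
      {h : Module.Dual (ZMod 2) (Fin (r + 1) → ZMod 2) // h ≠ 0}) := by
  classical
  have : Finite (Module.Dual (ZMod 2) (Fin (r + 1) → ZMod 2)) := Module.finite_of_finite (ZMod 2)
  have := Fintype.ofFinite (Module.Dual (ZMod 2) (Fin (r + 1) → ZMod 2))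
  rw [Fintype.bijective_iff_injective_and_card]
  constructor
  · intro k l hkl
    refine hadamardGen_row_injective r (funext fun j => ?_)
    rw [← hadamardFunctional_single, Subtype.mk.inj hkl, hadamardFunctional_single]
  · rw [Fintype.card_fin, Fintype.card_subtype_compl, Fintype.card_subtype_eq,
      Module.card_eq_pow_finrank (K := ZMod 2), Subspace.dual_finrank_eq, ZMod.card]
    simp

theorem coordFunctional_hadamardWords (k : Fin n) :
    coordFunctional (hadamardWords r n) k =
      if h : k.1 < 2 ^ (r + 1) - 1 then hadamardFunctional r ⟨k.1, h⟩ else 0 := by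
  ext c
  by_cases h : k.1 < 2 ^ (r + 1) - 1 <;> simp [hadamardWords, hadamardFunctional, h]

theorem balancedFamily_hadamardWords (hn : 2 ^ (r + 1) ≤ n) :
    BalancedFamily (2 ^ (r + 1)) (n - 2 ^ (r + 1)) (hadamardWords r n) := by
  rw [balancedFamily_iff]
  intro h
  rw [Module.finrank_fin_fun]
  by_cases hh : h = 0
  · subst hh
    have : (Finset.univ.filter fun k : Fin n => coordFunctional (hadamardWords r n) k = 0) =
        Finset.univ.filter fun k : Fin n => ¬ k.1 < 2 ^ (r + 1) - 1 := by
      ext k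
      simp only [Finset.mem_filter, Finset.mem_univ, true_and, coordFunctional_hadamardWords]
      split_ifs with h1
      · simp [h1, hadamardFunctional_ne_zero]
      · simp [h1]
    have hc := Finset.card_filter_add_card_filter_not (s := (Finset.univ : Finset (Fin n)))
      (fun k : Fin n => k.1 < 2 ^ (r + 1) - 1)
    rw [Fin.card_filter_val_lt, Finset.card_univ, Fintype.card_fin] at hc
    -- Padding contributes `n - (2 ^ (r + 1) - 1)` zero coordinates, one more than the surplus; `hn`
    -- keeps the subtraction from truncating.
    rw [this, if_pos rfl, show (Finset.univ.filter fun k : Fin n => ¬ k.1 < 2 ^ (r + 1) - 1).card =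
      n - 2 ^ (r + 1) + 1 by have := Nat.one_le_two_pow (n := r + 1); omega]
    ring
  · obtain ⟨k, hk⟩ := (hadamardFunctional_bijective r).2 ⟨h, hh⟩
    have hk : hadamardFunctional r k = h := congrArg Subtype.val hk
    have : (Finset.univ.filter fun k : Fin n => coordFunctional (hadamardWords r n) k = h) =
        {Fin.castLE ((Nat.sub_le _ _).trans hn) k} := by
      ext l
      simp only [Finset.mem_filter, Finset.mem_univ, true_and, coordFunctional_hadamardWords,
        Finset.mem_singleton]
      constructor
      · intro hl
        split_ifs at hl with h1
        · have := (hadamardFunctional_bijective r).1 (Subtype.ext (hl.trans hk.symm))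
          rw [← this]
          rfl
        · exact absurd hl.symm hh
      · rintro rfl
        simp [hk]
    rw [this, if_neg hh]
    simp

/-- Independent families complete to bases, and the added vectors are harmless because the padded
words vanish there. -/
theorem isTopFace_iff (hn : 2 ^ (r + 1) ≤ n) (t : Submodule (ZMod 2) (Ambient b n)) :
    IsTopFace r b n t ↔ ∃ P Q : Matrix (Fin n) (Fin n) (Fq b), IsUnit P ∧ IsUnit Q ∧
      t = LinearMap.range (framedMap P Q (hadamardWords r n)) := by
  have hn' : 2 ^ (r + 1) - 1 ≤ n := by omega
  constructor
  · rintro ⟨-, e, f, he, hf, rfl⟩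
    obtain ⟨E, hE, hEe⟩ := he.exists_extend_fin hn'
    obtain ⟨F, hF, hFf⟩ := hf.exists_extend_fin hn'
    refine ⟨(Matrix.of E).transpose, Matrix.of F, ?_, ?_, ?_⟩
    · exact (Matrix.isUnit_transpose _).mpr (Matrix.linearIndependent_rows_iff_isUnit.mp hE)
    · exact Matrix.linearIndependent_rows_iff_isUnit.mp hF
    · exact hadamardImage_eq_range hn' e f _ _ (fun k i => congrFun (hEe k) i)
        (fun k i => congrFun (hFf k) i)
  · rintro ⟨P, Q, hP, hQ, rfl⟩
    refine ⟨?_, fun k i => P i (Fin.castLE hn' k), fun k i => Q (Fin.castLE hn' k) i, ?_, ?_, ?_⟩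
    · rw [LinearMap.finrank_range_of_inj (framedMap_injective hP hQ
        ((balancedFamily_hadamardWords hn).injective (by positivity)))]
      simp
    · exact (Matrix.linearIndependent_cols_iff_isUnit.mpr hP).comp _ (Fin.castLE_injective hn')
    · exact (Matrix.linearIndependent_rows_iff_isUnit.mpr hQ).comp _ (Fin.castLE_injective hn')
    · exact (hadamardImage_eq_range hn' _ _ P Q (fun _ _ => rfl) (fun _ _ => rfl)).symm

/-- A subspace is a face if it is contained in a top-dimensional face. -/
def IsFace (r b n : ℕ) (x : Submodule (ZMod 2) (Ambient b n)) : Prop :=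
  ∃ y, IsTopFace r b n y ∧ x ≤ y

variable {W : Type*} [AddCommGroup W] [Module (ZMod 2) W] [FiniteDimensional (ZMod 2) W]

theorem IsFace.exists_framedMap (hn : 2 ^ (r + 1) ≤ n) {x : Submodule (ZMod 2) (Ambient b n)}
    (hx : IsFace r b n x) {ψ : W →ₗ[ZMod 2] Ambient b n} (hψ : Function.Injective ψ)
    (hψx : LinearMap.range ψ ≤ x) :
    ∃ (P Q : Matrix (Fin n) (Fin n) (Fq b)) (L : W →ₗ[ZMod 2] (Fin n → ZMod 2)),
      IsUnit P ∧ IsUnit Q ∧ BalancedFamily (2 ^ (r + 1)) (n - 2 ^ (r + 1)) L ∧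
        ψ = framedMap P Q L := by
  obtain ⟨y, hy, hxy⟩ := hx
  obtain ⟨P, Q, hP, hQ, rfl⟩ := (isTopFace_iff hn y).mp hy
  have hB := balancedFamily_hadamardWords hn
  have hf : Function.Injective (framedMap P Q (hadamardWords r n)) :=
    framedMap_injective hP hQ (hB.injective (by positivity))
  let ι : W →ₗ[ZMod 2] (Fin (r + 1) → ZMod 2) :=
    (LinearEquiv.ofInjective _ hf).symm.toLinearMap.comp
      (ψ.codRestrict _ fun w => hxy (hψx (LinearMap.mem_range_self ψ w)))
  have hι : (framedMap P Q (hadamardWords r n)).comp ι = ψ := by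
    refine LinearMap.ext fun w => ?_
    exact congrArg Subtype.val ((LinearEquiv.ofInjective _ hf).apply_symm_apply _)
  refine ⟨P, Q, (hadamardWords r n).comp ι, hP, hQ, hB.comp ?_, ?_⟩
  · refine Function.Injective.of_comp (f := framedMap P Q (hadamardWords r n)) ?_
    rw [← LinearMap.coe_comp, hι]
    exact hψ
  · rw [framedMap_comp, hι]

/-- Restricting the Hadamard words along any embedding of `W` gives a family with the same counts. A
permutation, absorbed into the frame, identifies it with `L`. -/
theorem BalancedFamily.isFace_range (hn : 2 ^ (r + 1) ≤ n) {P Q : Matrix (Fin n) (Fin n) (Fq b)}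
    (hP : IsUnit P) (hQ : IsUnit Q) {L : W →ₗ[ZMod 2] (Fin n → ZMod 2)}
    (hL : BalancedFamily (2 ^ (r + 1)) (n - 2 ^ (r + 1)) L)
    (hW : Module.finrank (ZMod 2) W ≤ r + 1) : IsFace r b n (LinearMap.range (framedMap P Q L)) := by
  have hB := balancedFamily_hadamardWords hn
  obtain ⟨j, hj⟩ : ∃ j : W →ₗ[ZMod 2] (Fin (r + 1) → ZMod 2), Function.Injective j := by
    rw [← finrank_le_iff_exists_linearMap]
    simpa using hW
  obtain ⟨π, hπ⟩ := hL.exists_perm (hB.comp hj)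
  refine ⟨_, (isTopFace_iff hn _).mpr ⟨_, _, isUnit_submatrix_id_equiv hP π.symm,
    isUnit_submatrix_equiv_id hQ π.symm, rfl⟩, ?_⟩
  rw [framedMap_reindex P Q hπ, framedMap_comp]
  exact LinearMap.range_comp_le_range _ _

end TopFaces

/-! ### Vertices of the link and changes of frame -/

section Link

open Matrix

variable {r b n : ℕ} {x : Submodule (ZMod 2) (Ambient b n)}

/-- The rank-zero elements of the link of a face. -/
def IsLinkVertex (r : ℕ) (x y : Submodule (ZMod 2) (Ambient b n)) : Prop :=
  IsFace r b n y ∧ x ≤ y ∧ Module.finrank (ZMod 2) y = Module.finrank (ZMod 2) x + 1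

/-- Two rank-zero elements of the link that lie below a common element of rank one. -/
def LinkAdj (r : ℕ) (x y y' : Submodule (ZMod 2) (Ambient b n)) : Prop :=
  IsLinkVertex r x y ∧ IsLinkVertex r x y' ∧ ∃ z, IsFace r b n z ∧
    Module.finrank (ZMod 2) z = Module.finrank (ZMod 2) x + 2 ∧ y ≤ z ∧ y' ≤ z

/-- A pair of invertible matrices that diagonalises `x` to the words `L`. -/
def IsFrame (x : Submodule (ZMod 2) (Ambient b n)) (L : x →ₗ[ZMod 2] (Fin n → ZMod 2))
    (P Q : Matrix (Fin n) (Fin n) (Fq b)) : Prop :=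
  IsUnit P ∧ IsUnit Q ∧ x.subtype = framedMap P Q L

/-- The extension of `x` by the word `s` in the frame `P`, `Q`. -/
noncomputable def wordExtension (L : x →ₗ[ZMod 2] (Fin n → ZMod 2)) (P Q : Matrix (Fin n) (Fin n) (Fq b))
    (s : Fin n → ZMod 2) : Submodule (ZMod 2) (Ambient b n) :=
  LinearMap.range (framedMap P Q (adjoinWord L s))

variable {L : x →ₗ[ZMod 2] (Fin n → ZMod 2)} {P Q : Matrix (Fin n) (Fin n) (Fq b)}

theorem adjoinWord_comp_inl {W D : Type*} [AddCommGroup W] [Module (ZMod 2) W]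
    (L : W →ₗ[ZMod 2] (D → ZMod 2)) (s : D → ZMod 2) :
    (adjoinWord L s).comp (LinearMap.inl _ _ _) = L := by
  simp [adjoinWord]

theorem IsFrame.le_wordExtension (h : IsFrame x L P Q) (s : Fin n → ZMod 2) :
    x ≤ wordExtension L P Q s := by
  intro w hw
  refine ⟨(⟨w, hw⟩, 0), ?_⟩
  have h1 : framedMap P Q (adjoinWord L s) (⟨w, hw⟩, 0) = framedMap P Q L ⟨w, hw⟩ := by
    rw [← adjoinWord_comp_inl L s, framedMap_comp, adjoinWord_comp_inl]
    rfl
  rw [h1, ← h.2.2]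
  rfl

theorem finrank_range_framedMap {W : Type*} [AddCommGroup W] [Module (ZMod 2) W]
    [FiniteDimensional (ZMod 2) W] {N e : ℕ} (hN : N ≠ 0) (hP : IsUnit P) (hQ : IsUnit Q)
    {L : W →ₗ[ZMod 2] (Fin n → ZMod 2)} (hL : BalancedFamily N e L) :
    Module.finrank (ZMod 2) (LinearMap.range (framedMap P Q L)) = Module.finrank (ZMod 2) W :=
  LinearMap.finrank_range_of_inj (framedMap_injective hP hQ (hL.injective hN))

theorem IsFrame.isLinkVertex (hn : 2 ^ (r + 1) ≤ n) (hx : Module.finrank (ZMod 2) x + 2 ≤ r + 1)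
    (h : IsFrame x L P Q) {s : Fin n → ZMod 2}
    (hs : Complementary (2 ^ (r + 1)) (n - 2 ^ (r + 1)) L s) :
    IsLinkVertex r x (wordExtension L P Q s) := by
  refine ⟨BalancedFamily.isFace_range hn h.1 h.2.1 hs ?_, h.le_wordExtension s, ?_⟩
  · rw [Module.finrank_prod, Module.finrank_self]
    omega
  · rw [wordExtension, finrank_range_framedMap (by positivity) h.1 h.2.1 hs,
      Module.finrank_prod, Module.finrank_self]

theorem IsFrame.linkAdj (hn : 2 ^ (r + 1) ≤ n) (hx : Module.finrank (ZMod 2) x + 2 ≤ r + 1)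
    (h : IsFrame x L P Q) {s u : Fin n → ZMod 2}
    (hs : JointlyComplementary (2 ^ (r + 1)) (n - 2 ^ (r + 1)) L s u) :
    LinkAdj r x (wordExtension L P Q s) (wordExtension L P Q u) := by
  refine ⟨h.isLinkVertex hn hx (Complementary.balancedFamily hs),
    h.isLinkVertex hn hx hs.complementary_right,
    LinearMap.range (framedMap P Q (adjoinWord (adjoinWord L s) u)), ?_, ?_, ?_, ?_⟩
  · refine BalancedFamily.isFace_range hn h.1 h.2.1 hs ?_
    rw [Module.finrank_prod, Module.finrank_prod, Module.finrank_self]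
    omega
  · rw [finrank_range_framedMap (by positivity) h.1 h.2.1 hs,
      Module.finrank_prod, Module.finrank_prod, Module.finrank_self]
  · rw [wordExtension]
    nth_rewrite 1 [← adjoinWord_comp_inl (adjoinWord L s) u]
    rw [framedMap_comp]
    exact LinearMap.range_comp_le_range _ _
  · have : adjoinWord L u = (adjoinWord (adjoinWord L s) u).comp
        ((LinearMap.inl (ZMod 2) x (ZMod 2)).prodMap LinearMap.id) := by
      refine LinearMap.ext fun ⟨w, t⟩ => funext fun k => ?_
      simp
    rw [wordExtension, this, framedMap_comp]
    exact LinearMap.range_comp_le_range _ _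

theorem IsFrame.eqvGen_linkAdj (hn : 2 ^ (r + 1) ≤ n)
    (hx : Module.finrank (ZMod 2) x + 2 ≤ r + 1)
    (h : IsFrame x L P Q) {s u : Fin n → ZMod 2}
    (hs : Complementary (2 ^ (r + 1)) (n - 2 ^ (r + 1)) L s)
    (hu : Complementary (2 ^ (r + 1)) (n - 2 ^ (r + 1)) L u) :
    Relation.EqvGen (LinkAdj r x) (wordExtension L P Q s) (wordExtension L P Q u) := by
  have hm : 2 ^ (r + 1) = 2 ^ (r + 1 - (Module.finrank (ZMod 2) x + 2)) *
      2 ^ (Module.finrank (ZMod 2) x + 2) := by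
    rw [← pow_add]; congr 1; omega
  have := hs.eqvGen_jointlyComplementary Nat.one_le_two_pow hm hu
  clear hs hu
  induction this with
  | rel _ _ h' => exact Relation.EqvGen.rel _ _ (h.linkAdj hn hx h')
  | refl _ => exact Relation.EqvGen.refl _
  | symm _ _ _ ih => exact ih.symm
  | trans _ _ _ _ _ ih1 ih2 => exact ih1.trans _ _ _ ih2

/-- A frame of `y` restricts to one of `x`, with words that are a permutation of the prescribed `L`;
permuting the frame makes them equal to `L`. -/
theorem IsLinkVertex.exists_frame (hn : 2 ^ (r + 1) ≤ n)
    (hL : BalancedFamily (2 ^ (r + 1)) (n - 2 ^ (r + 1)) L)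
    {y : Submodule (ZMod 2) (Ambient b n)} (hy : IsLinkVertex r x y) :
    ∃ P Q s, IsFrame x L P Q ∧ Complementary (2 ^ (r + 1)) (n - 2 ^ (r + 1)) L s ∧
      y = wordExtension L P Q s := by
  obtain ⟨hyF, hxy, hrank⟩ := hy
  have hne : x ≠ y := by
    rintro rfl
    omega
  obtain ⟨v, hvy, hvx⟩ := SetLike.exists_of_lt (lt_of_le_of_ne hxy hne)
  let ψ : x × ZMod 2 →ₗ[ZMod 2] Ambient b n :=
    x.subtype.coprod (LinearMap.toSpanSingleton (ZMod 2) _ v)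
  have hψ : Function.Injective ψ := by
    rw [injective_iff_map_eq_zero]
    rintro ⟨w, t⟩ h
    simp only [ψ, LinearMap.coprod_apply, Submodule.subtype_apply,
      LinearMap.toSpanSingleton_apply] at h
    rcases ZMod.eq_zero_or_one_of_two t with rfl | rfl
    · simpa using h
    · rw [one_smul] at h
      exact absurd (by rw [← neg_eq_of_add_eq_zero_right h]; exact x.neg_mem w.2) hvx
  have hle : LinearMap.range ψ ≤ y := by
    rintro _ ⟨⟨w, t⟩, rfl⟩
    exact y.add_mem (hxy w.2) (y.smul_mem t hvy)
  have hrange : LinearMap.range ψ = y := by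
    refine Submodule.eq_of_le_of_finrank_eq hle ?_
    rw [LinearMap.finrank_range_of_inj hψ, Module.finrank_prod, Module.finrank_self, hrank]
  obtain ⟨P, Q, L', hP, hQ, hL', hψL'⟩ := hyF.exists_framedMap hn hψ hle
  obtain ⟨π, hπ⟩ := (hL'.comp (ι := LinearMap.inl (ZMod 2) x (ZMod 2))
    LinearMap.inl_injective).exists_perm hL
  let s : Fin n → ZMod 2 := fun k => L' (0, 1) (π.symm k)
  have hadj : ∀ u k, adjoinWord L s u (π k) = L' u k := by
    rintro ⟨w, t⟩ k
    have : ((w, t) : x × ZMod 2) = (w, 0) + t • (0, 1) := by simp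
    rw [this, map_add, map_add, map_smul, map_smul]
    have h1 := hπ w k
    simp only [LinearMap.comp_apply, LinearMap.inl_apply] at h1
    simp [h1, s]
  have hs : BalancedFamily (2 ^ (r + 1)) (n - 2 ^ (r + 1)) (adjoinWord L s) :=
    hL'.reindex π.symm fun u k => by rw [← hadj, Equiv.apply_symm_apply]
  rw [framedMap_reindex P Q hadj] at hψL'
  refine ⟨_, _, s, ⟨isUnit_submatrix_id_equiv hP π.symm, isUnit_submatrix_equiv_id hQ π.symm, ?_⟩,
    hs, ?_⟩
  · rw [← adjoinWord_comp_inl L s, framedMap_comp, ← hψL']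
    simp [ψ]
  · rw [wordExtension, ← hψL', hrange]

/-- A pair of matrices fixing the words `L` whose action on frames does not change the component of
the corresponding vertices of the link. -/
def PreservesComponents (r : ℕ) (L : x →ₗ[ZMod 2] (Fin n → ZMod 2))
    (S T : Matrix (Fin n) (Fin n) (Fq b)) : Prop :=
  IsUnit S ∧ IsUnit T ∧ (∀ w, S * wordDiag (Fq b) (L w) * T = wordDiag (Fq b) (L w)) ∧
    ∀ P Q s, IsFrame x L P Q → Complementary (2 ^ (r + 1)) (n - 2 ^ (r + 1)) L s →
      Relation.EqvGen (LinkAdj r x) (wordExtension L (P * S) (T * Q) s) (wordExtension L P Q s)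

variable {S T S' T' : Matrix (Fin n) (Fin n) (Fq b)}

theorem IsFrame.mul (h : IsFrame x L P Q) (hS : IsUnit S) (hT : IsUnit T)
    (hST : ∀ w, S * wordDiag (Fq b) (L w) * T = wordDiag (Fq b) (L w)) :
    IsFrame x L (P * S) (T * Q) := by
  refine ⟨h.1.mul hS, hT.mul h.2.1, ?_⟩
  rw [h.2.2]
  refine LinearMap.ext fun w => ?_
  rw [framedMap_apply, framedMap_apply]
  nth_rewrite 1 [← hST w]
  simp only [Matrix.mul_assoc]

theorem PreservesComponents.mul (h : PreservesComponents r L S T)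
    (h' : PreservesComponents r L S' T') : PreservesComponents r L (S * S') (T' * T) := by
  refine ⟨h.1.mul h'.1, h'.2.1.mul h.2.1, fun w => ?_, fun P Q s hF hs => ?_⟩
  · rw [← Matrix.mul_assoc, Matrix.mul_assoc S, Matrix.mul_assoc S, h'.2.2.1, h.2.2.1]
  · have h1 := h'.2.2.2 _ _ s (hF.mul h.1 h.2.1 h.2.2.1) hs
    rw [Matrix.mul_assoc, ← Matrix.mul_assoc T'] at h1
    exact h1.trans _ _ _ (h.2.2.2 P Q s hF hs)

theorem preservesComponents_one : PreservesComponents r L 1 1 :=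
  ⟨isUnit_one, isUnit_one, fun w => by simp, fun P Q s _ _ => by
    rw [Matrix.mul_one, Matrix.one_mul]; exact Relation.EqvGen.refl _⟩

/-- The extension by `s` is the same subspace in both frames, and within each frame every extension
is connected to it. -/
theorem preservesComponents_of_fixes (hn : 2 ^ (r + 1) ≤ n)
    (hx : Module.finrank (ZMod 2) x + 2 ≤ r + 1) (hS : IsUnit S) (hT : IsUnit T)
    (hST : ∀ w, S * wordDiag (Fq b) (L w) * T = wordDiag (Fq b) (L w))
    {s : Fin n → ZMod 2} (hs : Complementary (2 ^ (r + 1)) (n - 2 ^ (r + 1)) L s)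
    (hfix : S * wordDiag (Fq b) s * T = wordDiag (Fq b) s) : PreservesComponents r L S T := by
  refine ⟨hS, hT, hST, fun P Q u hF hu => ?_⟩
  have hF' := hF.mul hS hT hST
  have heq : wordExtension L (P * S) (T * Q) s = wordExtension L P Q s := by
    unfold wordExtension
    congr 1
    refine LinearMap.prod_ext ?_ ?_
    · rw [← framedMap_comp, ← framedMap_comp, adjoinWord_comp_inl, ← hF.2.2, ← hF'.2.2]
    · ext1
      simp only [LinearMap.comp_apply, LinearMap.inr_apply, framedMap_apply]
      have : adjoinWord L s (0, 1) = s := by ext k; simp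
      rw [this]
      nth_rewrite 2 [← hfix]
      simp only [Matrix.mul_assoc]
  refine (hF'.eqvGen_linkAdj hn hx hu hs).trans _ _ _ ?_
  rw [heq]
  exact hF.eqvGen_linkAdj hn hx hs hu

theorem oneUpdateCol_mul_wordDiag {a : Fin n} {v : Fin n → Fq b} {s : Fin n → ZMod 2}
    (ha : s a = 0) : oneUpdateCol a v * wordDiag (Fq b) s = wordDiag (Fq b) s := by
  ext i j
  rw [wordDiag, Matrix.mul_diagonal, oneUpdateCol_apply, Matrix.diagonal_apply, Matrix.one_apply]
  by_cases hj : j = a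
  · subst hj
    by_cases hij : i = j
    · subst hij; simp [ha]
    · simp [ha, hij]
  · by_cases hij : i = j
    · subst hij; simp [hj]
    · simp [hj, hij]

theorem commute_wordDiag {s : Fin n → ZMod 2} (h : ∀ i j, S i j ≠ 0 → s i = s j) :
    S * wordDiag (Fq b) s = wordDiag (Fq b) s * S := by
  ext i j
  rw [wordDiag, Matrix.mul_diagonal, Matrix.diagonal_mul]
  by_cases hij : S i j = 0
  · simp [hij]
  · rw [h i j hij, mul_comm]

theorem isUnit_oneUpdateCol {a : Fin n} {v : Fin n → Fq b} (ha : v a ≠ 0) :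
    IsUnit (oneUpdateCol a v) :=
  IsUnit.of_mul_eq_one _ (oneUpdateCol_mul_pivotInv ha)

theorem two_pow_eq_mul_two_pow_finrank (hx : Module.finrank (ZMod 2) x + 2 ≤ r + 1) :
    2 ^ (r + 1) = 2 ^ (r - Module.finrank (ZMod 2) x) * 2 ^ (Module.finrank (ZMod 2) x + 1) := by
  rw [← pow_add]; congr 1; omega

theorem preservesComponents_oneUpdateCol (hn : 2 ^ (r + 1) ≤ n)
    (hx : Module.finrank (ZMod 2) x + 2 ≤ r + 1)
    (hL : BalancedFamily (2 ^ (r + 1)) (n - 2 ^ (r + 1)) L) {a : Fin n}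
    (ha : coordFunctional L a = 0) {v : Fin n → Fq b} (hv : v a ≠ 0) :
    PreservesComponents r L (oneUpdateCol a v) 1 ∧
      PreservesComponents r L 1 (oneUpdateCol a v)ᵀ := by
  -- Altering the column `a` has no effect on a diagonal word vanishing at `a`, so a word with `s a
  -- = 0` is fixed together with all of `L`.
  obtain ⟨s, hs, -, hB⟩ := hL.exists_complementary (two_pow_eq_mul_two_pow_finrank hx) ∅ {a}
    (by simp) (by simp) (fun k _ S hS _ => (Finset.card_le_card hS).trans Nat.one_le_two_pow)
  have hsa : s a = 0 := hB a (by simp)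
  have hLa : ∀ w, L w a = 0 := fun w => congrArg (fun g => g w) ha
  have htr : ∀ u : Fin n → ZMod 2, u a = 0 →
      wordDiag (Fq b) u * (oneUpdateCol a v)ᵀ = wordDiag (Fq b) u := by
    intro u hu
    have := congrArg Matrix.transpose (oneUpdateCol_mul_wordDiag (v := v) hu)
    rwa [Matrix.transpose_mul, wordDiag, Matrix.diagonal_transpose] at this
  constructor
  · refine preservesComponents_of_fixes hn hx (isUnit_oneUpdateCol hv) isUnit_one
      (fun w => ?_) hs ?_
    · rw [Matrix.mul_one, oneUpdateCol_mul_wordDiag (hLa w)]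
    · rw [Matrix.mul_one, oneUpdateCol_mul_wordDiag hsa]
  · refine preservesComponents_of_fixes hn hx isUnit_one
      ((Matrix.isUnit_transpose _).mpr (isUnit_oneUpdateCol hv)) (fun w => ?_) hs ?_
    · rw [Matrix.one_mul, htr _ (hLa w)]
    · rw [Matrix.one_mul, htr _ hsa]

open Classical in
/-- The coordinates at which all words of `L` vanish. -/
noncomputable def zeroCoords (L : x →ₗ[ZMod 2] (Fin n → ZMod 2)) : Finset (Fin n) :=
  Finset.univ.filter fun a => coordFunctional L a = 0

theorem mem_zeroCoords {a : Fin n} : a ∈ zeroCoords L ↔ coordFunctional L a = 0 := by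
  simp [zeroCoords]

theorem preservesComponents_left (hn : 2 ^ (r + 1) ≤ n)
    (hx : Module.finrank (ZMod 2) x + 2 ≤ r + 1)
    (hL : BalancedFamily (2 ^ (r + 1)) (n - 2 ^ (r + 1)) L) (hS : IsUnit S)
    (hc : ColsTrivialOff (zeroCoords L) S) : PreservesComponents r L S 1 := by
  refine elimination (c := fun _ => ()) (Φ := fun S => PreservesComponents r L S 1)
    preservesComponents_one (fun S T h h' => ?_) (zeroCoords L) (fun a ha v hv _ => ?_) S hS
    (fun _ _ _ => rfl) hc
  · simpa using h.mul h'
  · exact (preservesComponents_oneUpdateCol hn hx hL (mem_zeroCoords.mp ha) hv).1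

theorem preservesComponents_right (hn : 2 ^ (r + 1) ≤ n)
    (hx : Module.finrank (ZMod 2) x + 2 ≤ r + 1)
    (hL : BalancedFamily (2 ^ (r + 1)) (n - 2 ^ (r + 1)) L) (hT : IsUnit T)
    (hc : ColsTrivialOff (zeroCoords L) Tᵀ) : PreservesComponents r L 1 T := by
  rw [← Matrix.transpose_transpose T]
  refine elimination (c := fun _ => ()) (Φ := fun S => PreservesComponents r L 1 Sᵀ)
    (by simpa using preservesComponents_one) (fun S T h h' => ?_) (zeroCoords L)
    (fun a ha v hv _ => ?_) Tᵀ ((Matrix.isUnit_transpose _).mpr hT) (fun _ _ _ => rfl) hc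
  · simpa [Matrix.transpose_mul] using h.mul h'
  · exact (preservesComponents_oneUpdateCol hn hx hL (mem_zeroCoords.mp ha) hv).2

theorem preservesComponents_of_commute (hn : 2 ^ (r + 1) ≤ n)
    (hx : Module.finrank (ZMod 2) x + 2 ≤ r + 1) (hST : S * T = 1)
    (hSL : ∀ w, S * wordDiag (Fq b) (L w) = wordDiag (Fq b) (L w) * S)
    {s : Fin n → ZMod 2} (hs : Complementary (2 ^ (r + 1)) (n - 2 ^ (r + 1)) L s)
    (hfix : S * wordDiag (Fq b) s = wordDiag (Fq b) s * S) : PreservesComponents r L S T := by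
  refine preservesComponents_of_fixes hn hx (IsUnit.of_mul_eq_one _ hST)
    (IsUnit.of_mul_eq_one _ (mul_eq_one_comm.mp hST)) (fun w => ?_) hs ?_
  · rw [hSL, Matrix.mul_assoc, hST, Matrix.mul_one]
  · rw [hfix, Matrix.mul_assoc, hST, Matrix.mul_one]

theorem preservesComponents_blocks (hn : 2 ^ (r + 1) ≤ n)
    (hx : Module.finrank (ZMod 2) x + 2 ≤ r + 1)
    (hL : BalancedFamily (2 ^ (r + 1)) (n - 2 ^ (r + 1)) L) (hS : IsUnit S)
    (hb : RespectsBlocks (coordFunctional L) S) (hc : ColsTrivialOff (zeroCoords L)ᶜ S) :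
    PreservesComponents r L S S⁻¹ := by
  suffices H : ∃ T, S * T = 1 ∧ PreservesComponents r L S T by
    obtain ⟨T, hST, hT⟩ := H
    rwa [Matrix.inv_eq_right_inv hST]
  refine elimination (c := coordFunctional L)
    (Φ := fun S => ∃ T, S * T = 1 ∧ PreservesComponents r L S T)
    ⟨1, by simp, preservesComponents_one⟩ ?_ (zeroCoords L)ᶜ (fun a ha v hv hvb => ?_) S hS hb hc
  · rintro S S' ⟨T, hST, hT⟩ ⟨T', hST', hT'⟩
    refine ⟨T' * T, ?_, hT.mul hT'⟩
    rw [Matrix.mul_assoc, ← Matrix.mul_assoc S', hST', Matrix.one_mul, hST]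
  refine oneUpdateCol_of_transvections
    (Φ := fun S => ∃ T, S * T = 1 ∧ PreservesComponents r L S T) ?_ a v hv ?_ ?_
  · rintro S S' ⟨T, hST, hT⟩ ⟨T', hST', hT'⟩
    refine ⟨T' * T, ?_, hT.mul hT'⟩
    rw [Matrix.mul_assoc, ← Matrix.mul_assoc S', hST', Matrix.one_mul, hST]
  -- Diagonal matrices commute with every word, so any complementary word will do.
  · obtain ⟨s, hs, -⟩ := hL.exists_complementary (two_pow_eq_mul_two_pow_finrank hx) ∅ ∅
      (by simp) (by simp) (by simp)
    have hne : ∀ k, (if k = a then v a else 1) ≠ 0 := by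
      intro k; split_ifs <;> simp [hv]
    have hcomm : ∀ u : Fin n → ZMod 2,
        (Matrix.diagonal fun k => if k = a then v a else 1) * wordDiag (Fq b) u =
          wordDiag (Fq b) u * (Matrix.diagonal fun k => if k = a then v a else 1) := fun u =>
      commute_wordDiag fun i j hij => by
        rw [Matrix.diagonal_apply] at hij
        split_ifs at hij with h1 <;> simp_all
    refine ⟨Matrix.diagonal fun k => (if k = a then v a else 1)⁻¹, ?_,
      preservesComponents_of_commute hn hx ?_ (fun w => hcomm _) hs (hcomm s)⟩ <;>
    · rw [Matrix.diagonal_mul_diagonal, ← Matrix.diagonal_one]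
      congr 1
      ext k
      exact mul_inv_cancel₀ (hne k)
  · intro k hka hvk t
    -- The transvection commutes with words that agree at `a` and `k`. Both may lie in one fibre, so
    -- two ones per fibre are needed; `hx` gives that room.
    have hcard : ({a, k} : Finset (Fin n)).card ≤ 2 ^ (r - Module.finrank (ZMod 2) x) := by
      refine (Finset.card_le_two).trans ?_
      calc 2 = 2 ^ 1 := rfl
        _ ≤ _ := Nat.pow_le_pow_right two_pos (by omega)
    obtain ⟨s, hs, hA, -⟩ := hL.exists_complementary (two_pow_eq_mul_two_pow_finrank hx) {a, k} ∅
      (by simp) (fun _ _ S hS _ => (Finset.card_le_card hS).trans hcard) (by simp)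
    set u : Fin n → Fq b := fun j => if j = a then 1 else if j = k then t else 0 with hu
    have hua : u a ≠ 0 := by simp [hu]
    have hcomm : ∀ z : Fin n → ZMod 2, z k = z a →
        oneUpdateCol a u * wordDiag (Fq b) z = wordDiag (Fq b) z * oneUpdateCol a u := by
      intro z hz
      refine commute_wordDiag fun i j hij => ?_
      rw [oneUpdateCol_apply] at hij
      split_ifs at hij with h1
      · rw [h1]
        by_cases hia : i = a
        · rw [hia]
        · by_cases hik : i = k
          · rw [hik, hz]
          · simp [hu, hia, hik] at hij
      · by_contra hne
        exact hij (Matrix.one_apply_ne fun h => hne (by rw [h]))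
    refine ⟨_, oneUpdateCol_mul_pivotInv hua, preservesComponents_of_commute hn hx
      (oneUpdateCol_mul_pivotInv hua) (fun w => hcomm _ ?_) hs (hcomm s ?_)⟩
    · exact congrArg (fun g => g w) (hvb k hvk)
    · rw [hA a (by simp), hA k (by simp)]

/-- If `g` and `h` are both `1` at `v`, any `w` where they differ works either itself or after
adding `v`. -/
theorem exists_separating {W : Type*} [AddCommGroup W] [Module (ZMod 2) W]
    {g h : Module.Dual (ZMod 2) W} (hg : g ≠ 0) (hgh : g ≠ h) : ∃ w, g w = 1 ∧ h w = 0 := by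
  obtain ⟨v, hv⟩ := DFunLike.ne_iff.mp hg
  obtain ⟨w, hw⟩ := DFunLike.ne_iff.mp hgh
  have hv1 : g v = 1 := (ZMod.eq_zero_or_one_of_two _).resolve_left hv
  rcases ZMod.eq_zero_or_one_of_two (h v) with h1 | h1
  · exact ⟨v, hv1, h1⟩
  rcases ZMod.eq_zero_or_one_of_two (g w) with h2 | h2 <;>
    rcases ZMod.eq_zero_or_one_of_two (h w) with h3 | h3
  · exact absurd (h2.trans h3.symm) hw
  · refine ⟨v + w, by simp [hv1, h2], ?_⟩
    rw [map_add, h1, h3]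
    decide
  · exact ⟨w, h2, h3⟩
  · exact absurd (h2.trans h3.symm) hw

/-- Away from the zero coordinates, `S` and the inverse of `T` have a common block-diagonal part
`B`. The pair `(S, T)` factors into `(1, B * T)`, `(B, B⁻¹)` and `(B⁻¹ * S, 1)`; the outer two are
nontrivial only in rows, respectively columns, at zero coordinates. -/
theorem preservesComponents_of_fixes_words (hn : 2 ^ (r + 1) ≤ n)
    (hx : Module.finrank (ZMod 2) x + 2 ≤ r + 1)
    (hL : BalancedFamily (2 ^ (r + 1)) (n - 2 ^ (r + 1)) L) (hS : IsUnit S) (hT : IsUnit T)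
    (hST : ∀ w, S * wordDiag (Fq b) (L w) * T = wordDiag (Fq b) (L w)) :
    PreservesComponents r L S T := by
  classical
  set R := T⁻¹ with hR
  have hTdet := (Matrix.isUnit_iff_isUnit_det T).mp hT
  -- Entrywise form of `S * diag (L w) = diag (L w) * T⁻¹`; testing it on separating `w` gives the
  -- next three facts.
  have hentry : ∀ w k l, S k l * algebraMap (ZMod 2) (Fq b) (L w l) =
      algebraMap (ZMod 2) (Fq b) (L w k) * R k l := by
    intro w k l
    have h1 : S * wordDiag (Fq b) (L w) = wordDiag (Fq b) (L w) * R := by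
      nth_rewrite 2 [← hST w]
      rw [Matrix.mul_assoc, hR, Matrix.mul_nonsing_inv _ hTdet, Matrix.mul_one]
    have h2 := congrFun (congrFun h1 k) l
    rwa [wordDiag, Matrix.mul_diagonal, Matrix.diagonal_mul] at h2
  have hcol : ∀ k l, coordFunctional L l ≠ 0 → coordFunctional L k ≠ coordFunctional L l →
      S k l = 0 := by
    intro k l hl hkl
    obtain ⟨w, h1, h2⟩ := exists_separating hl hkl.symm
    have := hentry w k l
    rw [coordFunctional_apply] at h1 h2
    simpa [h1, h2] using this
  have hrow : ∀ k l, coordFunctional L k ≠ 0 → coordFunctional L k ≠ coordFunctional L l →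
      R k l = 0 := by
    intro k l hk hkl
    obtain ⟨w, h1, h2⟩ := exists_separating hk hkl
    have := hentry w k l
    rw [coordFunctional_apply] at h1 h2
    simpa [h1, h2] using this.symm
  have hblock : ∀ k l, coordFunctional L k ≠ 0 → coordFunctional L k = coordFunctional L l →
      S k l = R k l := by
    intro k l hk hkl
    obtain ⟨w, h1, -⟩ := exists_separating hk hk
    have h2 : coordFunctional L l w = 1 := by rw [← hkl, h1]
    have := hentry w k l
    rw [coordFunctional_apply] at h1 h2
    simpa [h1, h2] using this
  let B : Matrix (Fin n) (Fin n) (Fq b) := Matrix.of fun k l =>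
    if coordFunctional L l = 0 then (1 : Matrix (Fin n) (Fin n) (Fq b)) k l else S k l
  have hB0 : ∀ k l, coordFunctional L l = 0 → B k l = (1 : Matrix (Fin n) (Fin n) (Fq b)) k l :=
    fun k l h => by simp [B, h]
  have hB1 : ∀ k l, coordFunctional L l ≠ 0 → B k l = S k l := fun k l h => by simp [B, h]
  have hBR : ∀ k l, coordFunctional L k ≠ 0 → B k l = R k l := by
    intro k l hk
    by_cases hkl : coordFunctional L k = coordFunctional L l
    · rw [hB1 k l (hkl ▸ hk), hblock k l hk hkl]
    · rw [hrow k l hk hkl]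
      by_cases hl : coordFunctional L l = 0
      · rw [hB0 k l hl, Matrix.one_apply_ne fun h => hkl (by rw [h])]
      · rw [hB1 k l hl, hcol k l hl hkl]
  -- The rows of `B` at zero coordinates are those of `1`, so a kernel vector vanishes there. On
  -- such vectors `B` and `S` agree, and `S` is injective.
  have hBunit : IsUnit B := by
    rw [← Matrix.mulVec_injective_iff_isUnit]
    refine (injective_iff_map_eq_zero B.mulVecLin).mpr fun v hv => ?_
    rw [Matrix.mulVecLin_apply] at hv
    have hz : ∀ k, coordFunctional L k = 0 → v k = 0 := by
      intro k hk
      have h1 := congrFun hv k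
      rw [Matrix.mulVec, dotProduct, Finset.sum_eq_single k] at h1
      · rw [hB0 k k hk] at h1
        simpa using h1
      · intro l _ hlk
        by_cases hl : coordFunctional L l = 0
        · rw [hB0 k l hl, Matrix.one_apply_ne hlk.symm, zero_mul]
        · rw [hB1 k l hl, hcol k l hl (by rw [hk]; exact Ne.symm hl), zero_mul]
      · simp
    have hSv : S *ᵥ v = 0 := by
      rw [← hv]
      ext k
      rw [Matrix.mulVec, Matrix.mulVec, dotProduct, dotProduct]
      refine Finset.sum_congr rfl fun l _ => ?_
      by_cases hl : coordFunctional L l = 0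
      · rw [hz l hl, mul_zero, mul_zero]
      · rw [hB1 k l hl]
    exact Matrix.mulVec_injective_iff_isUnit.mpr hS (by rw [hSv, Matrix.mulVec_zero])
  have hBdet := (Matrix.isUnit_iff_isUnit_det B).mp hBunit
  have hBinv : IsUnit B⁻¹ := Matrix.isUnit_nonsing_inv_iff.mpr hBunit
  have p1 : PreservesComponents r L B B⁻¹ := by
    refine preservesComponents_blocks hn hx hL hBunit (fun k l hkl => ?_) (fun l hl k => ?_)
    · by_contra hne
      by_cases hl : coordFunctional L l = 0
      · rw [hB0 k l hl] at hkl
        exact hkl (Matrix.one_apply_ne fun h => hne (by rw [h]))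
      · exact hkl ((hB1 k l hl).trans (hcol k l hl hne))
    · rw [Finset.mem_compl, not_not, mem_zeroCoords] at hl
      exact hB0 k l hl
  have p2 : PreservesComponents r L (B⁻¹ * S) 1 := by
    refine preservesComponents_left hn hx hL (hBinv.mul hS) fun l hl k => ?_
    rw [mem_zeroCoords] at hl
    rw [← Matrix.nonsing_inv_mul B hBdet, Matrix.mul_apply, Matrix.mul_apply]
    exact Finset.sum_congr rfl fun j _ => by rw [hB1 j l hl]
  have p3 : PreservesComponents r L 1 (B * T) := by
    refine preservesComponents_right hn hx hL (hBunit.mul hT) fun l hl k => ?_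
    rw [mem_zeroCoords] at hl
    rw [Matrix.transpose_apply, ← Matrix.transpose_one, Matrix.transpose_apply,
      ← Matrix.nonsing_inv_mul T hTdet, Matrix.mul_apply, Matrix.mul_apply]
    exact Finset.sum_congr rfl fun j _ => by rw [hBR l j hl]
  have := (p3.mul p1).mul p2
  rwa [Matrix.one_mul, Matrix.one_mul, ← Matrix.mul_assoc, ← Matrix.mul_assoc,
    Matrix.mul_nonsing_inv B hBdet, Matrix.nonsing_inv_mul B hBdet, Matrix.one_mul,
    Matrix.one_mul] at this

/-- The transition between the two frames fixes the words of `L`, so `y'` can be moved into the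
frame of `y` within its component. -/
theorem IsLinkVertex.eqvGen_linkAdj (hn : 2 ^ (r + 1) ≤ n)
    (hx : Module.finrank (ZMod 2) x + 2 ≤ r + 1)
    (hL : BalancedFamily (2 ^ (r + 1)) (n - 2 ^ (r + 1)) L)
    {y y' : Submodule (ZMod 2) (Ambient b n)} (hy : IsLinkVertex r x y)
    (hy' : IsLinkVertex r x y') : Relation.EqvGen (LinkAdj r x) y y' := by
  obtain ⟨P, Q, s, hF, hs, rfl⟩ := hy.exists_frame hn hL
  obtain ⟨P', Q', s', hF', hs', rfl⟩ := hy'.exists_frame hn hL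
  have hPdet := (Matrix.isUnit_iff_isUnit_det P).mp hF.1
  have hQdet := (Matrix.isUnit_iff_isUnit_det Q).mp hF.2.1
  have hPC : PreservesComponents r L (P⁻¹ * P') (Q' * Q⁻¹) := by
    refine preservesComponents_of_fixes_words hn hx hL
      ((Matrix.isUnit_nonsing_inv_iff.mpr hF.1).mul hF'.1)
      (hF'.2.1.mul (Matrix.isUnit_nonsing_inv_iff.mpr hF.2.1)) fun w => ?_
    have h1 : P * wordDiag (Fq b) (L w) * Q = P' * wordDiag (Fq b) (L w) * Q' :=
      congrArg (fun f => f w) (hF.2.2.symm.trans hF'.2.2)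
    calc P⁻¹ * P' * wordDiag (Fq b) (L w) * (Q' * Q⁻¹)
        = P⁻¹ * (P' * wordDiag (Fq b) (L w) * Q') * Q⁻¹ := by simp only [Matrix.mul_assoc]
      _ = P⁻¹ * (P * wordDiag (Fq b) (L w) * Q) * Q⁻¹ := by rw [h1]
      _ = (P⁻¹ * P) * wordDiag (Fq b) (L w) * (Q * Q⁻¹) := by simp only [Matrix.mul_assoc]
      _ = wordDiag (Fq b) (L w) := by
        rw [Matrix.nonsing_inv_mul P hPdet, Matrix.mul_nonsing_inv Q hQdet, Matrix.one_mul,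
          Matrix.mul_one]
  have h2 := hPC.2.2.2 P Q s' hF hs'
  rw [← Matrix.mul_assoc, Matrix.mul_nonsing_inv P hPdet, Matrix.one_mul, Matrix.mul_assoc,
    Matrix.nonsing_inv_mul Q hQdet, Matrix.mul_one] at h2
  exact (hF.eqvGen_linkAdj hn hx hs hs').trans _ _ _ h2.symm

end Link

/-! ### Transfer to the 1-skeleton graph -/

section Skeleton

variable {r b n : ℕ}

/-- A vertex of the 1-skeleton of the link, from the underlying subspace. -/
def IsLinkVertex.toVertex {x : Grass r b n} {y : Submodule (ZMod 2) (Ambient b n)}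
    (hy : IsLinkVertex r x.1 y) :
    {v : Set.Ici x // linkRank (grassRank (r := r) (b := b) (n := n)) x v = 0} :=
  ⟨⟨⟨y, hy.1⟩, hy.2.1⟩, by
    have := hy.2.2
    simp only [linkRank, grassRank]
    omega⟩

theorem isLinkVertex_of_vertex {x : Grass r b n}
    (v : {v : Set.Ici x // linkRank (grassRank (r := r) (b := b) (n := n)) x v = 0}) :
    IsLinkVertex r x.1 v.1.1.1 := by
  refine ⟨v.1.1.2, v.1.2, ?_⟩
  have := v.2
  simp only [linkRank, grassRank] at this
  omega

theorem LinkAdj.reachable {x : Grass r b n} {y y' : Submodule (ZMod 2) (Ambient b n)}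
    (h : LinkAdj r x.1 y y') :
    (skeletonGraph (linkRank (grassRank (r := r) (b := b) (n := n)) x)).Reachable
      h.1.toVertex h.2.1.toVertex := by
  obtain ⟨hy, hy', z, hz, hzr, hyz, hyz'⟩ := h
  by_cases heq : y = y'
  · subst heq; rfl
  refine SimpleGraph.Adj.reachable ⟨fun h => heq ?_, ⟨⟨z, hz⟩, hy.2.1.trans hyz⟩, ?_, ?_, ?_⟩
  · exact congrArg (fun v => v.1.1.1) h
  · simp only [linkRank, grassRank]
    omega
  · refine lt_of_le_of_ne hyz fun h => ?_
    have h1 : y = z := congrArg (fun v => v.1.1) h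
    have := hy.2.2
    rw [h1] at this
    omega
  · refine lt_of_le_of_ne hyz' fun h => ?_
    have h1 : y' = z := congrArg (fun v => v.1.1) h
    have := hy'.2.2
    rw [h1] at this
    omega

/-- The equivalence of vertex conditions is carried along because, in the transitive case, the
intermediate subspace must be known to be a vertex. -/
theorem reachable_of_eqvGen {x : Grass r b n} {y y' : Submodule (ZMod 2) (Ambient b n)}
    (h : Relation.EqvGen (LinkAdj r x.1) y y') :
    (IsLinkVertex r x.1 y ↔ IsLinkVertex r x.1 y') ∧
    ∀ (hy : IsLinkVertex r x.1 y) (hy' : IsLinkVertex r x.1 y'),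
      (skeletonGraph (linkRank (grassRank (r := r) (b := b) (n := n)) x)).Reachable
        hy.toVertex hy'.toVertex := by
  induction h with
  | rel _ _ h => exact ⟨⟨fun _ => h.2.1, fun _ => h.1⟩, fun _ _ => h.reachable⟩
  | refl _ => exact ⟨Iff.rfl, fun _ _ => SimpleGraph.Reachable.refl _⟩
  | symm _ _ _ ih => exact ⟨ih.1.symm, fun h h' => (ih.2 h' h).symm⟩
  | trans _ _ _ _ _ ih1 ih2 =>
    exact ⟨ih1.1.trans ih2.1, fun h h' => (ih1.2 h (ih1.1.mp h)).trans (ih2.2 _ h')⟩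

end Skeleton

theorem mainTheorem6 (r b n : ℕ) (hr : 1 ≤ r) (hb : 2 ≤ b) (hn : 2 ^ (r + 1) ≤ n)
    (i : ℤ) (hi : -1 ≤ i) (hir : i ≤ (r : ℤ) - 2)
    (x : Grass r b n) (hx : grassRank x = i) :
    (skeletonGraph (linkRank (grassRank (r := r) (b := b) (n := n)) x)).Connected := by
  have hfr : Module.finrank (ZMod 2) x.1 + 2 ≤ r + 1 := by
    simp only [grassRank] at hx
    omega
  obtain ⟨P, Q, L, hP, hQ, hL, hxL⟩ := IsFace.exists_framedMap hn x.2
    (ψ := x.1.subtype) x.1.subtype_injective (by simp)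
  -- Connectedness includes nonemptiness: some complementary word exists, and it yields a vertex.
  obtain ⟨s, hs, -⟩ := hL.exists_complementary (two_pow_eq_mul_two_pow_finrank hfr) ∅ ∅
    (by simp) (by simp) (by simp)
  have hv : IsLinkVertex r x.1 (wordExtension L P Q s) :=
    IsFrame.isLinkVertex hn hfr ⟨hP, hQ, hxL⟩ hs
  have : Nonempty {v : Set.Ici x // linkRank (grassRank (r := r) (b := b) (n := n)) x v = 0} :=
    ⟨hv.toVertex⟩
  refine SimpleGraph.Connected.mk fun v w => ?_
  have hv := isLinkVertex_of_vertex v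
  have hw := isLinkVertex_of_vertex w
  exact (reachable_of_eqvGen (hv.eqvGen_linkAdj hn hfr hL hw)).2 hv hw
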